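/- Let $p>q$ be prime numbers, let $g\ge 1$ be an integer, and put $n=gq+1$. Let $e$ be the least positive integer with $p^e\equiv 1 \pmod q$. Assume that $p^e>n$ and $p\ge n+q-2$. For $s\ge 1$ put $$\Phi_s(t,z)=\big((t-z_1)\cdots(t-z_n)\big)^{(p^{es}-1)/q}\in\mathbb Z[z_1,\dots,z_n][t].$$ Let $A_s(z)$ be the $g\times g$ Hasse--Witt matrix whose $(u,v)$ entry ($1\le u,v\le g$) is the coefficient of $t^{p^{es}v-u}$ in $\Phi_s(t,z)$. Let $I_s(z)$ be the $n\times g$ matrix whose $(i,\ell)$ entry ($1\le i\le n$, $1\le \ell\le g$) is the coefficient of $t^{\ell p^{es}-1}$ in $\Phi_s(t,z)/(t-z_i)$. Let $m\ge 1$, let $K=\mathbb Q_p^{(m)}$ be the unramified extension of $\mathbb Q_p$ of degree $m$, with the norm $|\cdot|_p$ that extends the $p$-adic norm, and let $\mathbb Z_p^{(m)}=\{x\in K: |x|_p\le 1\}$. Define $$\mathfrak D=\mathfrak D^{(m)}_{\mathrm{KZ}}=\{a\in(\mathbb Z_p^{(m)})^n : |\det A_1(a)|_p=1\},\qquad \mathfrak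 D^{o}=\mathfrak D^{(m),o}_{\mathrm{KZ}}=\{a\in\mathfrak D : a_i\ne a_j \text{ for all } i\neq j\},$$ and $W=\{(x_1,\dots,x_n)\in K^n : x_1+\dots+x_n=0\}$. Then: 1. $|\det A_s(a)|_p=1$ for all $s\ge1$ and $a\in\mathfrak D$; the matrices $I_s(a)A_s(a)^{-1}$ converge as $s\to\infty$, uniformly on $\mathfrak D$, to an $n\times g$ matrix $\mathcal I(a)$; the entries of $\mathcal I$ are analytic at every point of $\mathfrak D$; and for every $a\in\mathfrak D$ the subspace $\mathcal L_a\subset K^n$ spanned by the columns of $\mathcal I(a)$ is contained in $W$. 2. The function $a\mapsto \dim_{K}\mathcal L_a$ is constant on $\mathfrak D^{o}$, say equal to $r$, and $\mathcal L=\bigcup_a\mathcal L_a$ is an analytic vector subbundle of rank $r$ of the trivial bundle over $\mathfrak D^{o}$: every point of $\mathfrak D^{o}$ has an open neighbourhood $U\subset\mathfrak D^{o}$ with analytic maps $s_1,\dots,s_r:U\to K^n$ such that $s_1(x),\dots,s_r(x)$ is a basis of $\mathcal L_x$ for every $x\in U$. -/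

import Mathlib

open Filter Topology

noncomputable section

namespace PadicKZ

/-- The unramified extension of `ℚ_p` of degree `m` inside the algebraic closure of `ℚ_p`: it is
obtained by adjoining the primitive roots of unity of order `p ^ m - 1`. As a subfield of
`PadicAlgCl p` it carries the norm that extends the `p`-adic norm. -/
def UnramifiedExt (p m : ℕ) [Fact p.Prime] : IntermediateField ℚ_[p] (PadicAlgCl p) :=
  IntermediateField.adjoin ℚ_[p] {ζ : PadicAlgCl p | IsPrimitiveRoot ζ (p ^ m - 1)}

/-- The order of `p` modulo `q`: the least positive `e` with `p ^ e ≡ 1` modulo `q`. -/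
def ordMod (p q : ℕ) : ℕ := orderOf (p : ZMod q)

/-- The exponent `(p ^ (e s) - 1) / q` of the master polynomial, where `e` is the order of `p`
modulo `q`; the division is exact. -/
def masterExp (p q s : ℕ) : ℕ := (p ^ (ordMod p q * s) - 1) / q

theorem masterExp_mul {p q s : ℕ} (hp : 0 < p) : masterExp p q s * q + 1 = p ^ (ordMod p q * s) := by
  have h1 : ((p ^ (ordMod p q * s) : ℕ) : ZMod q) = 1 := by
    rw [Nat.cast_pow, pow_mul, ordMod, pow_orderOf_eq_one, one_pow]
  have h2 : 1 ≤ p ^ (ordMod p q * s) := Nat.one_le_pow _ _ hp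
  have h3 : q ∣ p ^ (ordMod p q * s) - 1 := by
    rw [← ZMod.natCast_eq_zero_iff, Nat.cast_sub h2, h1, Nat.cast_one, sub_self]
  rw [masterExp, Nat.div_mul_cancel h3]
  omega

/-- The polynomial `((t - z_1) ⋯ (t - z_n)) ^ N` in `ℤ[z_1, …, z_n][t]`. -/
def powProd (n N : ℕ) : Polynomial (MvPolynomial (Fin n) ℤ) :=
  ∏ j : Fin n, (Polynomial.X - Polynomial.C (MvPolynomial.X j)) ^ N

/-- The quotient of `((t - z_1) ⋯ (t - z_n)) ^ N` by `t - z_i` (for `0 < N`). -/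
def powProdQuot (n N : ℕ) (i : Fin n) : Polynomial (MvPolynomial (Fin n) ℤ) :=
  (Polynomial.X - Polynomial.C (MvPolynomial.X i)) ^ (N - 1) *
    ∏ j ∈ Finset.univ.erase i, (Polynomial.X - Polynomial.C (MvPolynomial.X j)) ^ N

theorem mul_powProdQuot {n N : ℕ} (hN : 0 < N) (i : Fin n) :
    (Polynomial.X - Polynomial.C (MvPolynomial.X i)) * powProdQuot n N i = powProd n N := by
  rw [powProdQuot, ← mul_assoc, ← pow_succ', Nat.sub_add_cancel hN, powProd]
  exact Finset.mul_prod_erase Finset.univ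
    (fun j : Fin n => (Polynomial.X - Polynomial.C (MvPolynomial.X j) :
      Polynomial (MvPolynomial (Fin n) ℤ)) ^ N) (Finset.mem_univ i)

/-- The master polynomial
`Φ_s(t, z) = ((t - z_1) ⋯ (t - z_n)) ^ ((p ^ (e s) - 1) / q)` with `n = g q + 1`. -/
def masterPoly (p q g s : ℕ) : Polynomial (MvPolynomial (Fin (g * q + 1)) ℤ) :=
  powProd (g * q + 1) (masterExp p q s)

/-- The Hasse--Witt matrix `A(Φ_s)`: for `u, v = 1, …, g` its `(u, v)` entry is the coefficient of
`t ^ (p ^ (e s) v - u)` in `Φ_s(t, z)` (the indices `u, v` below start at `0`). -/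
def hasseWitt (p q g s : ℕ) : Matrix (Fin g) (Fin g) (MvPolynomial (Fin (g * q + 1)) ℤ) :=
  Matrix.of fun u v =>
    (masterPoly p q g s).coeff (p ^ (ordMod p q * s) * ((v : ℕ) + 1) - ((u : ℕ) + 1))

/-- The matrix `I_s(z)` of `p ^ (e s)`-hypergeometric solutions: for `ℓ = 1, …, g` its `(i, ℓ)`
entry is the coefficient of `t ^ (ℓ p ^ (e s) - 1)` in `Φ_s(t, z) / (t - z_i)` (the index `ℓ` below
starts at `0`). -/
def hypergeomSol (p q g s : ℕ) :
    Matrix (Fin (g * q + 1)) (Fin g) (MvPolynomial (Fin (g * q + 1)) ℤ) :=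
  Matrix.of fun i l =>
    (powProdQuot (g * q + 1) (masterExp p q s) i).coeff
      (((l : ℕ) + 1) * p ^ (ordMod p q * s) - 1)

/-- The value at a point `a ∈ K ^ n` of a matrix of polynomials with integer coefficients. -/
def evalMatrix {K : Type*} [Field K] {n : ℕ} {α β : Type*}
    (M : Matrix α β (MvPolynomial (Fin n) ℤ)) (a : Fin n → K) : Matrix α β K :=
  M.map (MvPolynomial.aeval a)

/-- The domain of `a ∈ K ^ n` with `|a_i| ≤ 1` for all `i` and `|det A(Φ_1)(a)| = 1`. -/
def kzDomain (p q g : ℕ) (K : Type*) [NormedField K] : Set (Fin (g * q + 1) → K) :=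
  {a | (∀ i, ‖a i‖ ≤ 1) ∧ ‖(evalMatrix (hasseWitt p q g 1) a).det‖ = 1}

/-- The part of `kzDomain` in the complement of the diagonal hyperplanes. -/
def kzDomainOff (p q g : ℕ) (K : Type*) [NormedField K] : Set (Fin (g * q + 1) → K) :=
  {a | a ∈ kzDomain p q g K ∧ ∀ i j, i ≠ j → a i ≠ a j}

/-- The matrix `I_s(a) ⬝ A(Φ_s)(a)⁻¹`. -/
def normalizedSol {K : Type*} [Field K] (p q g s : ℕ) (a : Fin (g * q + 1) → K) :
    Matrix (Fin (g * q + 1)) (Fin g) K :=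
  evalMatrix (hypergeomSol p q g s) a * (evalMatrix (hasseWitt p q g s) a)⁻¹

/-- The matrix `𝓘(a)`, the entrywise limit of `I_s(a) ⬝ A(Φ_s)(a)⁻¹` as `s → ∞`. -/
def limitSol {K : Type*} [NormedField K] (p q g : ℕ) (a : Fin (g * q + 1) → K) :
    Matrix (Fin (g * q + 1)) (Fin g) K :=
  Matrix.of fun i l => limUnder atTop fun s : ℕ => normalizedSol p q g s a i l

/-- The fiber `W = {(I_1, …, I_n) | I_1 + ⋯ + I_n = 0}` of the trivial bundle. -/
def sumZero (n : ℕ) (K : Type*) [Field K] : Submodule K (Fin n → K) where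
  carrier := {x | ∑ i, x i = 0}
  add_mem' {x y} hx hy := by
    have hx' : ∑ i, x i = 0 := hx
    have hy' : ∑ i, y i = 0 := hy
    simp [Finset.sum_add_distrib, hx', hy']
  zero_mem' := by simp
  smul_mem' c x hx := by
    have hx' : ∑ i, x i = 0 := hx
    simp [← Finset.mul_sum, hx']

/-- The space `𝓛_a`, spanned by the columns of the matrix `𝓘(a)`. -/
def fiberL {K : Type*} [NormedField K] (p q g : ℕ) (a : Fin (g * q + 1) → K) :
    Submodule K (Fin (g * q + 1) → K) :=
  Submodule.span K (Set.range (limitSol p q g a).col)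

/-- A family of subspaces `L a` of a normed space `E` is an analytic vector subbundle of rank `r`
of the trivial bundle with fiber `E` over `D`, if around every point of `D` it has an analytic
frame: analytic sections `s_1, …, s_r` whose values at each point form a basis of the fiber. -/
def IsAnalyticSubbundle {K V E : Type*} [NontriviallyNormedField K] [NormedAddCommGroup V]
    [NormedSpace K V] [NormedAddCommGroup E] [NormedSpace K E]
    (D : Set V) (L : V → Submodule K E) (r : ℕ) : Prop :=
  ∀ a ∈ D, ∃ U : Set V, IsOpen U ∧ a ∈ U ∧ U ⊆ D ∧ ∃ s : Fin r → V → E,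
    (∀ j, AnalyticOnNhd K (s j) U) ∧
    ∀ x ∈ U, LinearIndependent K (fun j => s j x) ∧
      Submodule.span K (Set.range fun j => s j x) = L x

end PadicKZ

end

/-! Write `Q = p ^ e`, `N k = (Q ^ k - 1) / q`, `n = g q + 1` and `P = ∏ (t - a_i)`. The entries of
`A_k` and `I_k` are values of the same `g` functionals `f ↦ [t ^ (v Q ^ k - 1)] P ^ (N k - 1) f`, at
`f = P t ^ u` and at `f = P / (t - a_i)`. For `v > g` such a functional vanishes on degrees below `n
+ g`. Because `N (k + 1) = N k + N 1 * Q ^ k`, modulo `p ^ k` the functionals of level `k + 1` are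
combinations of those of level `k` (`DworkData.coeffMul_mem`). One matrix of coefficients serves
both `A` and `I`, so `I_k A_k⁻¹` changes only by a multiple of `p ^ k`
(`DworkData.normalized_congr`). Invertibility of `A_k` follows from `A_{k+1} ≡ A_k * Frob(A_1)`
modulo `p`.

All this works over any ring in which `p` is a non-zero-divisor in the Jacobson radical. Over the
unit ball of `K` it gives uniform convergence. Over power series, at the generic point `a + X`, it
gives an integral power series whose sum is `𝓘` near `a`, hence analyticity.

For the rank, the functionals kill the exact forms `q P f' - P' f` modulo `Q ^ k`. The case `f = 1`
says that the columns of `𝓘` sum to zero. A relation `c` between the columns yields functionals that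
tend to zero on every `P / (t - a_i)` and on exact forms. For distinct `a_i` these span `K[t]`, as
`q ∤ n` (`mem_of_exact_mem`). The value at `P t ^ u` is constantly `c_u`, so `c = 0`. Hence `r = g`,
and the columns of `𝓘` form a global frame. -/

namespace PadicKZ

open Polynomial Finset Matrix

/-! ### Congruences between linear functionals on polynomials of bounded degree -/

section Functionals

variable {R : Type*} [CommRing R]

/-- The functional `f ↦ [t ^ i] (G f)` on polynomials. -/
noncomputable def coeffMul (G : R[X]) (i : ℕ) : R[X] →ₗ[R] R :=
  (lcoeff R i).comp (LinearMap.mulLeft R G)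

@[simp] theorem coeffMul_apply (G : R[X]) (i : ℕ) (f : R[X]) : coeffMul G i f = (G * f).coeff i :=
  rfl

theorem coeffMul_mul (G F : R[X]) (i : ℕ) :
    coeffMul (G * F) i = ∑ x ∈ antidiagonal i, F.coeff x.2 • coeffMul G x.1 := by
  refine LinearMap.ext fun f => ?_
  rw [LinearMap.sum_apply, coeffMul_apply, mul_right_comm, coeff_mul]
  exact Finset.sum_congr rfl fun x _ => by simp [mul_comm]

/-- The functionals that agree modulo `c`, on polynomials of degree less than `d`, with linear
combinations of the functionals `lam`. -/
def congrSpan {ι : Type*} [Fintype ι] (c : R) (d : ℕ) (lam : ι → R[X] →ₗ[R] R) :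
    Submodule R (R[X] →ₗ[R] R) where
  carrier := {φ | ∃ b : ι → R, ∀ f : R[X], f.natDegree < d → c ∣ φ f - ∑ v, b v * lam v f}
  add_mem' := by
    rintro φ ψ ⟨b, hb⟩ ⟨b', hb'⟩
    refine ⟨b + b', fun f hf => ?_⟩
    convert dvd_add (hb f hf) (hb' f hf) using 1
    simp only [LinearMap.add_apply, Pi.add_apply, add_mul, Finset.sum_add_distrib]
    ring
  zero_mem' := ⟨0, fun f _ => by simp⟩
  smul_mem' := by
    rintro r φ ⟨b, hb⟩
    refine ⟨r • b, fun f hf => ?_⟩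
    convert dvd_mul_of_dvd_right (hb f hf) r using 1
    simp only [LinearMap.smul_apply, Pi.smul_apply, smul_eq_mul, mul_sub, Finset.mul_sum, mul_assoc]

variable {ι : Type*} [Fintype ι] {c : R} {d : ℕ} {lam mu : ι → R[X] →ₗ[R] R}

theorem self_mem_congrSpan [DecidableEq ι] (v : ι) : lam v ∈ congrSpan c d lam :=
  ⟨Pi.single v 1, fun f _ => by simp [Pi.single_apply]⟩

theorem mem_congrSpan_of_dvd {φ : R[X] →ₗ[R] R} (h : ∀ f : R[X], f.natDegree < d → c ∣ φ f) :
    φ ∈ congrSpan c d lam := ⟨0, fun f hf => by simpa using h f hf⟩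

theorem smul_mem_congrSpan {c' x : R} {φ : R[X] →ₗ[R] R} (hx : c' ∣ x)
    (h : φ ∈ congrSpan c d lam) : x • φ ∈ congrSpan (c' * c) d lam := by
  obtain ⟨b, hb⟩ := h
  refine ⟨x • b, fun f hf => ?_⟩
  convert mul_dvd_mul hx (hb f hf) using 1
  simp only [LinearMap.smul_apply, Pi.smul_apply, smul_eq_mul, mul_sub, Finset.mul_sum, mul_assoc]

theorem congrSpan_le (h : ∀ v, lam v ∈ congrSpan c d mu) :
    congrSpan c d lam ≤ congrSpan c d mu := by
  rintro φ ⟨b, hb⟩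
  have h1 : ∑ v, b v • lam v ∈ congrSpan c d mu :=
    Submodule.sum_mem _ fun v _ => Submodule.smul_mem _ _ (h v)
  have h2 : φ - ∑ v, b v • lam v ∈ congrSpan c d mu :=
    mem_congrSpan_of_dvd fun f hf => by simpa using hb f hf
  simpa using Submodule.add_mem _ h2 h1

theorem det_dvd_sub [DecidableEq ι] {A B : Matrix ι ι R} (h : ∀ i j, c ∣ A i j - B i j) :
    c ∣ A.det - B.det := by
  rw [← Ideal.mem_span_singleton, ← Ideal.Quotient.eq, RingHom.map_det, RingHom.map_det]
  congr 1
  ext i j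
  simpa [Ideal.Quotient.eq, Ideal.mem_span_singleton] using h i j

/-- If `mu` consists of combinations of `lam` modulo `c`, and both have invertible matrices on the
same test polynomials, then `lam` consists of combinations of `mu` modulo `c`. -/
theorem mem_congrSpan_symm [DecidableEq ι] (w : ι → R[X]) (hw : ∀ u, (w u).natDegree < d)
    (hJ : ∀ x y : R, c ∣ x - y → IsUnit x → IsUnit y)
    (hmu : IsUnit (Matrix.of fun u v => mu v (w u)).det)
    (h : ∀ v, mu v ∈ congrSpan c d lam) (v : ι) : lam v ∈ congrSpan c d mu := by
  choose b hb using h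
  set B : Matrix ι ι R := Matrix.of fun v' v => b v v' with hB
  have hB1 : ∀ f : R[X], f.natDegree < d → ∀ v, c ∣ mu v f - ((fun v => lam v f) ᵥ* B) v := by
    intro f hf v
    convert hb v f hf using 2
    simp [Matrix.vecMul, dotProduct, hB, mul_comm]
  -- On the test polynomials, `lam * B ≡ mu` modulo `c` and `det mu` is a unit. So `det lam * det B`
  -- is a unit, and the transition matrix can be inverted.
  have hu : IsUnit B.det := by
    have h1 : IsUnit ((Matrix.of fun u v => lam v (w u)) * B).det := by
      refine hJ _ _ (det_dvd_sub fun u v => ?_) hmu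
      exact hB1 (w u) (hw u) v
    rw [Matrix.det_mul] at h1
    exact isUnit_of_mul_isUnit_right h1
  refine ⟨fun v' => B⁻¹ v' v, fun f hf => ?_⟩
  have h2 : lam v f = (((fun v => lam v f) ᵥ* B) ᵥ* B⁻¹) v := by
    rw [Matrix.vecMul_vecMul, Matrix.mul_nonsing_inv _ hu, Matrix.vecMul_one]
  have h3 : lam v f - ∑ v', B⁻¹ v' v * mu v' f
      = -∑ v', (mu v' f - ((fun v => lam v f) ᵥ* B) v') * B⁻¹ v' v := by
    conv_lhs => rw [h2]
    simp only [Matrix.vecMul, dotProduct]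
    rw [← Finset.sum_sub_distrib, ← Finset.sum_neg_distrib]
    exact Finset.sum_congr rfl fun _ _ => by ring
  rw [h3]
  exact (Finset.dvd_sum fun v' _ => dvd_mul_of_dvd_left (hB1 f hf v') _).neg_right

end Functionals

/-! ### Divisibility of the coefficients of `H ^ (Q ^ k)` -/

section Divisibility

variable {R : Type*} [CommRing R] {p : ℕ} [Fact p.Prime]

theorem dvd_of_pow_dvd_natCast_mul (hp : ∀ x : R, (p : R) * x = 0 → x = 0) {e k j i : ℕ} {x : R}
    (hi : ¬ (p ^ e) ^ (j + 1) ∣ i) (h : (((p ^ e) ^ k : ℕ) : R) ∣ i * x) (hjk : j < k) :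
    (p : R) ^ (k - j) ∣ x := by
  have hp1 := (Fact.out : p.Prime)
  have hi0 : i ≠ 0 := by rintro rfl; simp at hi
  obtain ⟨w, i', hi', rfl⟩ := Nat.exists_eq_pow_mul_and_not_dvd hi0 p hp1.ne_one
  have hw : w < e * (j + 1) := by
    by_contra! hw
    exact hi (by rw [← pow_mul]; exact dvd_mul_of_dvd_left (pow_dvd_pow p hw) _)
  have hek : e * (j + 1) ≤ e * k := Nat.mul_le_mul_left e hjk
  have hpow : ∀ (w : ℕ) (x : R), (p : R) ^ w * x = 0 → x = 0 := by
    intro w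
    induction w with
    | zero => simp
    | succ w ih => intro x hx; exact ih x (hp _ (by rw [← hx]; ring))
  obtain ⟨y, hy⟩ := h
  have h1 : (p : R) ^ (e * k - w) ∣ i' * x := by
    refine ⟨y, sub_eq_zero.1 (hpow w _ ?_)⟩
    rw [mul_sub, ← mul_assoc, ← mul_assoc, ← pow_add, Nat.add_sub_cancel' (by omega)]
    push_cast at hy
    rw [sub_eq_zero, hy, pow_mul]
  have h2 : IsCoprime ((p : R) ^ (e * k - w)) (i' : R) := by
    have := ((Nat.Prime.coprime_iff_not_dvd hp1).2 hi').isCoprime.map (Int.castRingHom R)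
    simpa using this.pow_left (m := e * k - w)
  -- With `w` the `p`-valuation of `i`, `w ≤ e (j + 1) - 1` gives `e k - w ≥ e (k - j - 1) + 1 ≥ k -
  -- j`; the last inequality needs `e ≥ 1`.
  refine (pow_dvd_pow _ ?_).trans (h2.dvd_of_dvd_mul_left h1)
  obtain ⟨r, rfl⟩ := Nat.exists_eq_add_of_lt hjk
  have : 1 ≤ e := by
    rcases Nat.eq_zero_or_pos e with rfl | he
    · simp at hw
    · exact he
  have h3 : r + 1 ≤ e * (r + 1) := Nat.le_mul_of_pos_left _ this
  have h4 : e * (j + r + 1) = e * j + e * (r + 1) := by ring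
  have h5 : e * (j + 1) = e * j + e := by ring
  have h6 : e * (r + 1) = e * r + e := by ring
  have h7 : r ≤ e * r := Nat.le_mul_of_pos_left _ this
  omega

/-- The derivative of `H ^ (Q ^ k)` is a multiple of `Q ^ k`, so `i` times the coefficient of `t ^
i` is too. -/
theorem pow_dvd_coeff_pow (hp : ∀ x : R, (p : R) * x = 0 → x = 0) {e k j i : ℕ} (H : R[X])
    (hi : ¬ (p ^ e) ^ (j + 1) ∣ i) (hjk : j < k) :
    (p : R) ^ (k - j) ∣ (H ^ (p ^ e) ^ k).coeff i := by
  refine dvd_of_pow_dvd_natCast_mul hp hi ?_ hjk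
  obtain _ | i := i
  · simp
  have h := coeff_derivative (H ^ (p ^ e) ^ k) i
  rw [derivative_pow, mul_assoc, coeff_C_mul] at h
  exact ⟨_, by push_cast at h ⊢; rw [mul_comm, ← h]⟩

end Divisibility

end PadicKZ

namespace PadicKZ

open Polynomial Finset Matrix

/-! ### Dwork congruences -/

section Dwork

/-- The matrix with `(u, v)` entry `[t ^ (Q ^ k (v + 1) - (u + 1))] P ^ (N k)`. -/
noncomputable def coeffMatrix {R : Type*} [CommRing R] (Q g : ℕ) (N : ℕ → ℕ) (P : R[X]) (k : ℕ) :
    Matrix (Fin g) (Fin g) R :=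
  Matrix.of fun u v => (P ^ N k).coeff (Q ^ k * ((v : ℕ) + 1) - ((u : ℕ) + 1))

theorem coeffMatrix_map {R S : Type*} [CommRing R] [CommRing S] (φ : R →+* S) (Q g : ℕ)
    (N : ℕ → ℕ) (P : R[X]) (k : ℕ) :
    coeffMatrix Q g N (P.map φ) k = (coeffMatrix Q g N P k).map φ := by
  ext u v
  simp [coeffMatrix, ← Polynomial.map_pow]

/-- Numerical data of the exponents: `N k = (Q ^ k - 1) / q`. -/
structure ExpData (Q q g : ℕ) (N : ℕ → ℕ) : Prop where
  exp : ∀ k, N k * q + 1 = Q ^ k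
  q_pos : 0 < q
  g_lt : g < Q
  g_pos : 0 < g

variable {Q q g : ℕ} {N : ℕ → ℕ}

theorem ExpData.Q_pos (h : ExpData Q q g N) : 0 < Q := by have := h.g_lt; omega

theorem ExpData.one_lt (h : ExpData Q q g N) : 1 < Q := by
  have := h.g_lt; have := h.g_pos; omega

theorem ExpData.N_lt (h : ExpData Q q g N) (k : ℕ) : N k < Q ^ k := by
  rw [← h.exp k]
  exact Nat.lt_succ_of_le (Nat.le_mul_of_pos_right _ h.q_pos)

theorem ExpData.le_pow (h : ExpData Q q g N) {k : ℕ} (hk : 1 ≤ k) : Q ≤ Q ^ k :=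
  (pow_one Q).symm.le.trans (Nat.pow_le_pow_right h.Q_pos hk)

theorem ExpData.N_pos (h : ExpData Q q g N) {k : ℕ} (hk : 1 ≤ k) : 0 < N k := by
  have h1 := h.exp k
  have h2 := h.one_lt
  have h3 := h.le_pow hk
  rcases Nat.eq_zero_or_pos (N k) with h0 | h0
  · rw [h0] at h1; omega
  · exact h0

theorem ExpData.N_add (h : ExpData Q q g N) (j k : ℕ) : N (j + k) = N j + N k * Q ^ j := by
  have h1 := h.exp (j + k)
  rw [pow_add, ← h.exp j, ← h.exp k] at h1
  have h2 : N (j + k) * q = (N j + N k * Q ^ j) * q := by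
    rw [← h.exp j]; linarith
  exact Nat.eq_of_mul_eq_mul_right h.q_pos h2

variable {R : Type*} [CommRing R]

/-- This fixes the degree bound `n + g` used throughout: `(N k - 1) n + n + g = g Q ^ k + N k` and
`N k < Q ^ k`. -/
theorem ExpData.natDegree_lt (h : ExpData Q q g N) {P f : R[X]} {k : ℕ} (hk : 1 ≤ k)
    (hP : P.natDegree ≤ g * q + 1) (hf : f.natDegree < (g * q + 1) + g) :
    (P ^ (N k - 1) * f).natDegree < (g + 1) * Q ^ k - 1 := by
  have h1 : (P ^ (N k - 1) * f).natDegree ≤ (N k - 1) * (g * q + 1) + f.natDegree :=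
    natDegree_mul_le.trans (Nat.add_le_add_right
      (natDegree_pow_le.trans (Nat.mul_le_mul_left _ hP)) _)
  have h2 := h.N_lt k
  have h3 := h.N_pos hk
  have h4 : (N k - 1) * (g * q + 1) + (g * q + 1) + g = g * Q ^ k + N k := by
    obtain ⟨M, hM⟩ : ∃ M, N k = M + 1 := ⟨N k - 1, by omega⟩
    rw [← h.exp k, hM, Nat.add_sub_cancel]
    ring
  rw [Nat.add_mul, one_mul]
  omega

theorem ExpData.coeff_eq_zero (h : ExpData Q q g N) {P f : R[X]} {k v : ℕ} (hk : 1 ≤ k)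
    (hP : P.natDegree ≤ g * q + 1) (hf : f.natDegree < (g * q + 1) + g) (hv : g < v) :
    (P ^ (N k - 1) * f).coeff (v * Q ^ k - 1) = 0 := by
  refine coeff_eq_zero_of_natDegree_lt ((h.natDegree_lt hk hP hf).trans_le ?_)
  exact Nat.sub_le_sub_right (Nat.mul_le_mul_right _ hv) 1

/-- Multiplication by `X ^ u` shifts the index, so the Hasse–Witt matrix records the functionals on
the test polynomials `P X ^ u`. -/
theorem ExpData.coeffMatrix_apply (h : ExpData Q q g N) (P : R[X]) {k : ℕ} (hk : 1 ≤ k)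
    (u v : Fin g) :
    coeffMatrix Q g N P k u v
      = (P ^ (N k - 1) * (P * X ^ (u : ℕ))).coeff (((v : ℕ) + 1) * Q ^ k - 1) := by
  have h1 := h.g_lt
  have h2 := h.le_pow hk
  have h3 : Q ^ k ≤ ((v : ℕ) + 1) * Q ^ k := Nat.le_mul_of_pos_left _ (Nat.succ_pos _)
  have hu := u.2
  rw [← mul_assoc, ← pow_succ, Nat.sub_add_cancel (h.N_pos hk), coeff_mul_X_pow', if_pos (by omega),
    coeffMatrix, Matrix.of_apply, mul_comm (Q ^ k)]
  congr 1
  omega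

/-- The functionals `f ↦ [t ^ ((v + 1) Q ^ k - 1)] P ^ (N k - 1) f`, for `v < g`. -/
noncomputable def masterFun (Q g : ℕ) (N : ℕ → ℕ) (P : R[X]) (k : ℕ) (v : Fin g) : R[X] →ₗ[R] R :=
  coeffMul (P ^ (N k - 1)) (((v : ℕ) + 1) * Q ^ k - 1)

theorem natDegree_test {P : R[X]} (hP : P.natDegree ≤ g * q + 1)
    (u : Fin g) : (P * X ^ (u : ℕ)).natDegree < (g * q + 1) + g := by
  have h1 : (P * X ^ (u : ℕ)).natDegree ≤ (g * q + 1) + (u : ℕ) :=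
    natDegree_mul_le.trans (Nat.add_le_add hP (natDegree_X_pow_le _))
  omega

section Congruence

variable {p e : ℕ}

/-- In characteristic `p`, `P ^ N (k + 1) = P ^ N k * (P ^ N 1) ^ (Q ^ k)`, and the last factor is a
Frobenius twist of `P ^ N 1` in the variable `t ^ (Q ^ k)`. -/
theorem ExpData.coeffMatrix_succ_of_expChar [ExpChar R p] (h : ExpData (p ^ e) q g N) {P : R[X]}
    (hP : P.natDegree ≤ g * q + 1) {k : ℕ} (hk : 1 ≤ k) :
    coeffMatrix (p ^ e) g N P (k + 1)
      = coeffMatrix (p ^ e) g N P k *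
        (coeffMatrix (p ^ e) g N P 1).map (iterateFrobenius R p (e * k)) := by
  ext u v
  set Q := p ^ e with hQ
  have hQk : p ^ (e * k) = Q ^ k := pow_mul _ _ _
  have hQ0 : 0 < Q ^ k := Nat.pow_pos h.Q_pos
  have hgQ := h.g_lt
  have h1 : P ^ (N (k + 1) - 1) * (P * X ^ (u : ℕ))
      = (P ^ (N k - 1) * (P * X ^ (u : ℕ))) *
        expand R (Q ^ k) ((P ^ N 1).map (iterateFrobenius R p (e * k))) := by
    rw [← hQk, ← map_expand, map_iterateFrobenius_expand, hQk, ← pow_mul, mul_right_comm,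
      ← pow_add, h.N_add]
    congr 2
    have := h.N_pos hk
    omega
  rw [h.coeffMatrix_apply P (by omega), h1, coeff_mul, Matrix.mul_apply]
  symm
  have key : ∀ w : Fin g, (((v : ℕ) + 1) * Q ^ (k + 1) - 1 : ℕ) =
      ((w : ℕ) + 1) * Q ^ k - 1 + (Q * ((v : ℕ) + 1) - ((w : ℕ) + 1)) * Q ^ k := by
    intro w
    have h2 : (w : ℕ) + 1 ≤ Q * ((v : ℕ) + 1) :=
      (Nat.succ_le_of_lt w.2).trans (hgQ.le.trans (Nat.le_mul_of_pos_right _ (Nat.succ_pos _)))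
    have h3 : 1 ≤ ((w : ℕ) + 1) * Q ^ k := Nat.mul_pos (Nat.succ_pos _) hQ0
    have h4 : ((v : ℕ) + 1) * Q ^ (k + 1)
        = ((w : ℕ) + 1) * Q ^ k + (Q * ((v : ℕ) + 1) - ((w : ℕ) + 1)) * Q ^ k := by
      rw [← Nat.add_mul, Nat.add_sub_cancel' h2]
      ring
    omega
  -- A nonzero term has second index `c Q ^ k`, hence first index `w Q ^ k - 1` with `w + c = Q (v +
  -- 1)`. The terms with `1 ≤ w ≤ g` form the matrix product, and those with `w > g` vanish by
  -- degree.
  refine Finset.sum_of_injOn (fun w : Fin g => (((w : ℕ) + 1) * Q ^ k - 1,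
    (Q * ((v : ℕ) + 1) - ((w : ℕ) + 1)) * Q ^ k)) ?_ ?_ ?_ ?_
  · intro w _ w' _ hw
    have h3 : 1 ≤ ((w : ℕ) + 1) * Q ^ k := Nat.mul_pos (Nat.succ_pos _) hQ0
    have h3' : 1 ≤ ((w' : ℕ) + 1) * Q ^ k := Nat.mul_pos (Nat.succ_pos _) hQ0
    have h4 := (Prod.ext_iff.1 hw).1
    simp only at h4
    have h5 : ((w : ℕ) + 1) * Q ^ k = ((w' : ℕ) + 1) * Q ^ k := by omega
    have := Nat.eq_of_mul_eq_mul_right hQ0 h5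
    exact Fin.ext (by omega)
  · intro w _
    simpa using (key w).symm
  · rintro ⟨a, b⟩ hx hx'
    rw [HasAntidiagonal.mem_antidiagonal] at hx
    simp only at hx ⊢
    rw [coeff_expand hQ0]
    split_ifs with hb
    · obtain ⟨c, rfl⟩ := hb
      have hv : 1 ≤ ((v : ℕ) + 1) * Q ^ (k + 1) :=
        Nat.mul_pos (Nat.succ_pos _) (Nat.pow_pos h.Q_pos)
      have h2 : a + 1 + Q ^ k * c = Q ^ k * (Q * ((v : ℕ) + 1)) := by
        rw [← mul_assoc, ← pow_succ, mul_comm _ ((v : ℕ) + 1)]; omega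
      obtain ⟨w, hw⟩ : Q ^ k ∣ a + 1 :=
        (Nat.dvd_add_left (dvd_mul_right _ c)).1 (h2 ▸ dvd_mul_right _ _)
      have hw0 : w ≠ 0 := by rintro rfl; simp at hw
      have h3 : w + c = Q * ((v : ℕ) + 1) := by
        rw [hw, ← Nat.mul_add] at h2
        exact Nat.eq_of_mul_eq_mul_left hQ0 h2
      by_cases hwg : w ≤ g
      · refine absurd ⟨⟨w - 1, by omega⟩, by simp, ?_⟩ hx'
        simp only [Nat.sub_add_cancel (Nat.pos_of_ne_zero hw0), Prod.mk.injEq]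
        refine ⟨by rw [mul_comm, ← hw]; rfl, ?_⟩
        rw [mul_comm, ← h3, Nat.add_sub_cancel_left]
      · have : a = w * Q ^ k - 1 := by rw [mul_comm, ← hw]; rfl
        rw [this, h.coeff_eq_zero hk hP (natDegree_test hP u) (by omega), zero_mul]
    · rw [mul_zero]
  · intro w _
    rw [h.coeffMatrix_apply P hk]
    simp only
    rw [coeff_expand_mul hQ0, coeff_map]
    simp [coeffMatrix]

/-- The assumptions on the ring and the polynomial under which the congruences hold: `p` is not a
zero divisor and lies in the Jacobson radical, and the first coefficient matrix is invertible. -/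
structure DworkData (R : Type*) [CommRing R] (p e q g : ℕ) (N : ℕ → ℕ) (P : R[X]) : Prop
    extends ExpData (p ^ e) q g N where
  torsion : ∀ x : R, (p : R) * x = 0 → x = 0
  jacobson : ∀ x y : R, (p : R) ∣ x - y → IsUnit x → IsUnit y
  degree : P.natDegree ≤ g * q + 1
  unit_one : IsUnit (coeffMatrix (p ^ e) g N P 1).det

variable {P : R[X]}

theorem DworkData.isUnit_det [Fact p.Prime] (D : DworkData R p e q g N P) {k : ℕ} (hk : 1 ≤ k) :
    IsUnit (coeffMatrix (p ^ e) g N P k).det := by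
  induction k, hk using Nat.le_induction with
  | base => exact D.unit_one
  | succ k hk ih =>
    -- If `p` is a unit, `jacobson` makes every element a unit, and no quotient of characteristic
    -- `p` is needed.
    by_cases hp : IsUnit (p : R)
    · exact D.jacobson 1 _ (hp.dvd) isUnit_one
    have := CharP.quotient R p hp
    have hE : ExpChar (R ⧸ Ideal.span {(p : R)}) p := ExpChar.prime Fact.out
    refine D.jacobson _ _ ?_ (ih.mul (D.unit_one.pow (p ^ (e * k))))
    rw [← Ideal.mem_span_singleton, ← Ideal.Quotient.eq, map_mul, map_pow, RingHom.map_det,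
      RingHom.map_det, RingHom.map_det]
    simp only [RingHom.mapMatrix_apply, ← coeffMatrix_map]
    rw [D.toExpData.coeffMatrix_succ_of_expChar (natDegree_map_le.trans D.degree) hk,
      Matrix.det_mul, ← iterateFrobenius_def, RingHom.map_det]
    rfl

theorem DworkData.isUnit_det_masterFun [Fact p.Prime] (D : DworkData R p e q g N P) {k : ℕ} (hk : 1 ≤ k) :
    IsUnit (Matrix.of fun u v : Fin g =>
      masterFun (p ^ e) g N P k v (P * X ^ (u : ℕ))).det := by
  convert D.isUnit_det hk using 2
  ext u v
  exact (D.coeffMatrix_apply P hk u v).symm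

theorem DworkData.coeffMul_mem_of_dvd (D : DworkData R p e q g N P) {k v : ℕ} (hk : 1 ≤ k)
    (hv : 1 ≤ v) (c : R) :
    coeffMul (P ^ (N k - 1)) (v * (p ^ e) ^ k - 1)
      ∈ congrSpan c ((g * q + 1) + g) (masterFun (p ^ e) g N P k) := by
  by_cases hvg : v ≤ g
  · have := self_mem_congrSpan (c := c) (d := (g * q + 1) + g) (lam := masterFun (p ^ e) g N P k)
      ⟨v - 1, by omega⟩
    simpa [masterFun, Nat.sub_add_cancel hv] using this
  · refine mem_congrSpan_of_dvd fun f hf => ?_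
    rw [coeffMul_apply, D.coeff_eq_zero hk D.degree hf (by omega)]
    exact dvd_zero _

/-- Dwork congruences: modulo `p ^ k`, the functionals attached to `P ^ (N k - 1) H ^ (Q ^ k)` are
combinations of those attached to `P ^ (N k - 1)`. -/
theorem DworkData.coeffMul_mem [Fact p.Prime] (D : DworkData R p e q g N P) {k : ℕ} (hk : 1 ≤ k) (H : R[X])
    {l : ℕ} (hl : 1 ≤ l) :
    coeffMul (P ^ (N k - 1) * H ^ (p ^ e) ^ k) (l * (p ^ e) ^ k - 1)
      ∈ congrSpan ((p : R) ^ k) ((g * q + 1) + g) (masterFun (p ^ e) g N P k) := by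
  induction k using Nat.strong_induction_on generalizing H l with
  | _ k ih =>
  set Q := p ^ e with hQ
  have hQ0 : ∀ j, 0 < Q ^ j := fun j => Nat.pow_pos D.Q_pos
  have hsplit : ∀ j, j ≤ k → 1 ≤ j →
      P ^ (N k - 1) = P ^ (N j - 1) * (P ^ N (k - j)) ^ Q ^ j := by
    intro j hj hj1
    have h1 : N (j + (k - j)) = N j + N (k - j) * Q ^ j := D.N_add j (k - j)
    have h2 := D.N_pos hj1
    rw [Nat.add_sub_cancel' hj] at h1
    rw [← pow_mul, ← pow_add]
    congr 1
    omega
  -- Each coefficient of `H ^ (Q ^ k)` weights a functional of `P ^ (N k - 1)`. If `Q ^ k ∣ b`, that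
  -- functional is a master functional or vanishes. Otherwise let `Q ^ j` be the exact power of `Q`
  -- in `b`: the weight is divisible by `p ^ (k - j)`, so the functional matters only modulo `p ^
  -- j`.
  rw [coeffMul_mul]
  refine Submodule.sum_mem _ ?_
  rintro ⟨a, b⟩ hab
  rw [HasAntidiagonal.mem_antidiagonal] at hab
  simp only at hab ⊢
  have hlQ : 1 ≤ l * Q ^ k := Nat.mul_pos hl (hQ0 k)
  have ha : ∀ j, j ≤ k → Q ^ j ∣ b → ∃ v, 1 ≤ v ∧ a = v * Q ^ j - 1 := by
    intro j hj hb
    have h1 : Q ^ j ∣ a + 1 + b := by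
      rw [show a + 1 + b = l * Q ^ k by omega]
      exact dvd_mul_of_dvd_right (pow_dvd_pow _ hj) _
    obtain ⟨v, hv⟩ := (Nat.dvd_add_left hb).1 h1
    refine ⟨v, Nat.pos_of_ne_zero (by rintro rfl; simp at hv), ?_⟩
    rw [mul_comm, ← hv]
    rfl
  by_cases hb : Q ^ k ∣ b
  · obtain ⟨v, hv, rfl⟩ := ha k le_rfl hb
    exact Submodule.smul_mem _ _ (D.coeffMul_mem_of_dvd hk hv _)
  obtain ⟨j, hjk, hj, hj'⟩ : ∃ j < k, Q ^ j ∣ b ∧ ¬ Q ^ (j + 1) ∣ b := by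
    by_contra! hcon
    have : ∀ j, j ≤ k → Q ^ j ∣ b := by
      intro j
      induction j with
      | zero => simp
      | succ j ih => exact fun h => hcon j (by omega) (ih (by omega))
    exact hb (this k le_rfl)
  have hdvd := pow_dvd_coeff_pow D.torsion H hj' hjk
  rcases Nat.eq_zero_or_pos j with rfl | hj0
  · refine mem_congrSpan_of_dvd fun f _ => ?_
    exact dvd_mul_of_dvd_left hdvd _
  obtain ⟨v, hv, rfl⟩ := ha j hjk.le hj
  have h1 : coeffMul (P ^ (N k - 1)) (v * Q ^ j - 1)
      ∈ congrSpan ((p : R) ^ j) ((g * q + 1) + g) (masterFun Q g N P j) := by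
    rw [hsplit j hjk.le hj0]
    exact ih j hjk hj0 _ hv
  have h2 : ∀ v, masterFun Q g N P k v
      ∈ congrSpan ((p : R) ^ j) ((g * q + 1) + g) (masterFun Q g N P j) := by
    intro v
    rw [masterFun, hsplit j hjk.le hj0, ← Nat.sub_add_cancel hjk.le, pow_add, ← mul_assoc,
      Nat.add_sub_cancel]
    exact ih j hjk hj0 _ (Nat.mul_pos (Nat.succ_pos _) (hQ0 _))
  -- By induction both the functional and the masters of level `k` are combinations of the masters
  -- of level `j`, modulo `p ^ j`. Both matrices on the test polynomials are invertible, so level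
  -- `j` can be re-expressed through level `k`.
  have h3 := congrSpan_le (mem_congrSpan_symm (fun u : Fin g => P * X ^ (u : ℕ))
    (fun u => natDegree_test D.degree u)
    (fun x y h => D.jacobson x y ((dvd_pow_self _ (by omega)).trans h))
    (D.isUnit_det_masterFun hk) h2) h1
  have h4 := smul_mem_congrSpan hdvd h3
  rwa [← pow_add, Nat.sub_add_cancel hjk.le] at h4

/-- The values of the functionals on `f i`, normalized by their values on `P X ^ u`, converge
`p`-adically. -/
theorem DworkData.normalized_congr [Fact p.Prime] (D : DworkData R p e q g N P) {k : ℕ} (hk : 1 ≤ k)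
    {ι : Type*} (f : ι → R[X]) (hf : ∀ i, (f i).natDegree < (g * q + 1) + g) :
    ∃ Z : Matrix ι (Fin g) R,
      (Matrix.of fun i v => masterFun (p ^ e) g N P (k + 1) v (f i)) *
          (coeffMatrix (p ^ e) g N P (k + 1))⁻¹ -
        (Matrix.of fun i v => masterFun (p ^ e) g N P k v (f i)) *
          (coeffMatrix (p ^ e) g N P k)⁻¹ = (p : R) ^ k • Z := by
  have h1 : ∀ v, masterFun (p ^ e) g N P (k + 1) v
      ∈ congrSpan ((p : R) ^ k) ((g * q + 1) + g) (masterFun (p ^ e) g N P k) := by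
    intro v
    have h2 : P ^ (N (k + 1) - 1) = P ^ (N k - 1) * (P ^ N 1) ^ (p ^ e) ^ k := by
      rw [← pow_mul, ← pow_add, D.N_add]
      congr 1
      have := D.N_pos hk
      omega
    rw [masterFun, h2, pow_succ', ← mul_assoc]
    exact D.coeffMul_mem hk _ (Nat.mul_pos (Nat.succ_pos _) D.Q_pos)
  choose b hb using h1
  -- The same `B` gives `A' = A B + p ^ k X` and `I' = I B + p ^ k Y`, so `I' A'⁻¹ - I A⁻¹ = p ^ k
  -- (Y - I A⁻¹ X) A'⁻¹`.
  set B : Matrix (Fin g) (Fin g) R := Matrix.of fun v' v => b v v' with hB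
  set A := coeffMatrix (p ^ e) g N P k with hA
  set A' := coeffMatrix (p ^ e) g N P (k + 1) with hA'
  set I := Matrix.of fun i v => masterFun (p ^ e) g N P k v (f i) with hI
  set I' := Matrix.of fun i v => masterFun (p ^ e) g N P (k + 1) v (f i) with hI'
  have hX : ∀ u v, (p : R) ^ k ∣ (A' - A * B) u v := by
    intro u v
    have := hb v (P * X ^ (u : ℕ)) (natDegree_test D.degree u)
    rw [Matrix.sub_apply, hA', D.coeffMatrix_apply P (by omega), Matrix.mul_apply]
    convert this using 1
    congr 1
    refine Finset.sum_congr rfl fun w _ => ?_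
    rw [hA, D.coeffMatrix_apply P hk, mul_comm]
    rfl
  have hY : ∀ i v, (p : R) ^ k ∣ (I' - I * B) i v := by
    intro i v
    convert hb v (f i) (hf i) using 1
    rw [Matrix.sub_apply, Matrix.mul_apply]
    congr 1
    exact Finset.sum_congr rfl fun w _ => mul_comm _ _
  choose X₀ hX₀ using hX
  choose Y₀ hY₀ using hY
  have hX1 : A' - A * B = (p : R) ^ k • Matrix.of X₀ := by ext u v; simp [← hX₀]
  have hY1 : I' - I * B = (p : R) ^ k • Matrix.of Y₀ := by ext u v; simp [← hY₀]
  have hu : IsUnit A.det := D.isUnit_det hk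
  have hu' : IsUnit A'.det := D.isUnit_det (by omega)
  refine ⟨Matrix.of Y₀ * A'⁻¹ - I * A⁻¹ * Matrix.of X₀ * A'⁻¹, ?_⟩
  rw [smul_sub, ← Matrix.smul_mul, ← hY1, ← Matrix.smul_mul, ← Matrix.mul_smul, ← hX1]
  have e1 : I * A⁻¹ * (A' - A * B) * A'⁻¹ = I * A⁻¹ - I * B * A'⁻¹ := by
    rw [Matrix.mul_sub, Matrix.sub_mul]
    congr 1
    · rw [Matrix.mul_assoc, Matrix.mul_nonsing_inv _ hu', Matrix.mul_one]
    · rw [Matrix.mul_assoc I, ← Matrix.mul_assoc A⁻¹, Matrix.nonsing_inv_mul _ hu, Matrix.one_mul]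
  rw [e1, Matrix.sub_mul]
  abel

end Congruence

end Dwork

end PadicKZ

namespace PadicKZ

/-! ### Analyticity of sums of integral power series -/

section AnalyticSeries

variable {K : Type*} [NontriviallyNormedField K] {n : ℕ}

/-- A monomial of degree `k` is the diagonal of a continuous multilinear map of norm at most
one. -/
theorem exists_multilinear_monomial (k : ℕ) (α : Fin n →₀ ℕ) :
    ∃ M : ContinuousMultilinearMap K (fun _ : Fin k => Fin n → K) K,
      (∀ y, ‖M y‖ ≤ ∏ j, ‖y j‖) ∧
      (α.degree = k → ∀ y : Fin n → K, M (fun _ => y) = α.prod fun i d => y i ^ d) := by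
  by_cases hk : α.degree = k
  swap
  · exact ⟨0, fun y => by simpa using Finset.prod_nonneg fun j _ => norm_nonneg _,
      fun h => absurd h hk⟩
  -- `l` lists the variables of the monomial with multiplicity; the `j`-th argument contributes its
  -- coordinate `l_j`.
  obtain ⟨l, hl⟩ : ∃ l : List (Fin n), (l : Multiset (Fin n)) = Finsupp.toMultiset α :=
    ⟨_, Multiset.coe_toList _⟩
  have hlen : l.length = k := by
    rw [← hk, ← Multiset.coe_card, hl, Finsupp.card_toMultiset]
    rfl
  have hprod : ∀ y : Fin n → K, (l.map y).prod = α.prod fun i d => y i ^ d := by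
    intro y
    rw [← Multiset.prod_coe, ← Multiset.map_coe, hl, Finsupp.toMultiset_map,
      Finsupp.prod_toMultiset, Finsupp.prod_mapDomain_index (by simp) (by simp [pow_add])]
  subst hlen
  refine ⟨(ContinuousMultilinearMap.mkPiAlgebra K (Fin l.length) K).compContinuousLinearMap
    fun j => ContinuousLinearMap.proj (l.get j), fun y => ?_, fun _ y => ?_⟩
  · simp only [ContinuousMultilinearMap.compContinuousLinearMap_apply,
      ContinuousMultilinearMap.mkPiAlgebra_apply, ContinuousLinearMap.proj_apply, norm_prod]
    exact Finset.prod_le_prod (fun _ _ => norm_nonneg _) fun j _ => norm_le_pi_norm _ _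
  · simp only [ContinuousMultilinearMap.compContinuousLinearMap_apply,
      ContinuousMultilinearMap.mkPiAlgebra_apply, ContinuousLinearMap.proj_apply]
    rw [← hprod y, ← List.prod_ofFn]
    congr 1
    exact (List.ext_get (by simp) (by simp))

/-- A function that is locally the sum of a power series with integral coefficients is analytic. -/
theorem analyticAt_of_hasSum [IsUltrametricDist K] (c : (Fin n →₀ ℕ) → K) (hc : ∀ α, ‖c α‖ ≤ 1)
    (f : (Fin n → K) → K) (a : Fin n → K)
    (h : ∀ y : Fin n → K, ‖y‖ < 1 →
      HasSum (fun α : Fin n →₀ ℕ => c α * α.prod fun i d => y i ^ d) (f (a + y))) :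
    AnalyticAt K f a := by
  choose M hM hM' using fun k => exists_multilinear_monomial (K := K) (n := n) k
  have hmem : ∀ (k : ℕ) (α : Fin n →₀ ℕ),
      α ∈ (Finset.univ : Finset (Fin n)).finsuppAntidiag k ↔ α.degree = k := by
    intro k α
    simp [Finset.mem_finsuppAntidiag, Finsupp.degree_eq_sum]
  set S : FormalMultilinearSeries K (Fin n → K) K := fun k =>
    ∑ α ∈ (Finset.univ : Finset (Fin n)).finsuppAntidiag k, c α • M k α with hS
  -- The ultrametric inequality bounds the degree `k` part independently of its number of monomials,
  -- so the radius is at least `1`.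
  have hbound : ∀ k, ‖S k‖ ≤ 1 := by
    intro k
    refine ContinuousMultilinearMap.opNorm_le_bound zero_le_one fun y => ?_
    rw [hS, one_mul, _root_.sum_apply]
    refine IsUltrametricDist.norm_sum_le_of_forall_le_of_nonneg
      (Finset.prod_nonneg fun _ _ => norm_nonneg _) fun α _ => ?_
    rw [_root_.smul_apply, norm_smul]
    exact (mul_le_mul (hc α) (hM k α y) (norm_nonneg _) zero_le_one).trans (one_mul _).le
  refine ⟨S, 1, ?_, one_pos, ?_⟩
  · refine S.le_radius_of_bound 1 (r := 1) fun k => ?_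
    simpa using hbound k
  · intro y hy
    have hy1 : ‖y‖ < 1 := by simpa [enorm_eq_nnnorm, ← NNReal.coe_lt_coe] using hy
    have h1 := h y hy1
    rw [← (Equiv.sigmaFiberEquiv (fun α : Fin n →₀ ℕ => α.degree)).hasSum_iff] at h1
    refine h1.sigma fun k => ?_
    have h2 := ((Finset.univ : Finset (Fin n)).finsuppAntidiag k).hasSum
      fun α => c α * α.prod fun i d => y i ^ d
    have h3 := (Equiv.subtypeEquivRight (hmem k)).symm.hasSum_iff.2 h2
    convert h3 using 1
    · rfl
    rw [hS, _root_.sum_apply]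
    refine Finset.sum_congr rfl fun α hα => ?_
    rw [_root_.smul_apply, hM' k α ((hmem k α).1 hα), smul_eq_mul]

end AnalyticSeries

/-! ### The unit ball of an ultrametric field and evaluation of power series -/

section UnitBall

variable (K : Type*) [NontriviallyNormedField K] [IsUltrametricDist K]

/-- The ring of elements of norm at most one. -/
def unitBall : Subring K where
  carrier := {x | ‖x‖ ≤ 1}
  mul_mem' {x y} hx hy := by
    simpa using mul_le_one₀ hx (norm_nonneg y) hy
  one_mem' := by simp
  add_mem' {x y} hx hy := (IsUltrametricDist.norm_add_le_max x y).trans (max_le hx hy)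
  zero_mem' := by simp
  neg_mem' {x} hx := by simpa using hx

variable {K}

theorem mem_unitBall {x : K} : x ∈ unitBall K ↔ ‖x‖ ≤ 1 := Iff.rfl

theorem unitBall.norm_le (x : unitBall K) : ‖(x : K)‖ ≤ 1 := x.2

theorem unitBall.dvd_iff {x y : unitBall K} (hx : (x : K) ≠ 0) : x ∣ y ↔ ‖(y : K)‖ ≤ ‖(x : K)‖ := by
  constructor
  · rintro ⟨z, rfl⟩
    simpa using mul_le_of_le_one_right (norm_nonneg (x : K)) z.2
  · intro h
    refine ⟨⟨y / x, ?_⟩, Subtype.ext (by simp [mul_div_cancel₀ _ hx])⟩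
    rw [mem_unitBall, norm_div]
    exact div_le_one_of_le₀ h (norm_nonneg _)

theorem unitBall.isUnit_iff {x : unitBall K} : IsUnit x ↔ ‖(x : K)‖ = 1 := by
  constructor
  · intro h
    obtain ⟨y, hy⟩ := h.exists_right_inv
    have h1 : ‖(x : K)‖ * ‖(y : K)‖ = 1 := by
      rw [← norm_mul, ← norm_one (α := K)]
      exact congrArg _ (congrArg Subtype.val hy)
    exact le_antisymm x.2 (h1 ▸ mul_le_of_le_one_right (norm_nonneg _) y.2)
  · intro h
    have h0 : (x : K) ≠ 0 := by rintro h0; simp [h0] at h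
    refine isUnit_of_dvd_one ((unitBall.dvd_iff h0).2 ?_)
    simp [h]

/-- Balls about `0` are ideals by the ultrametric inequality. Evaluation by `MvPowerSeries.aeval`
relies on this. -/
instance : IsLinearTopology (unitBall K) (unitBall K) := by
  have hb : (𝓝 (0 : unitBall K)).HasBasis (fun ε : ℝ => 0 < ε) (Metric.ball 0) :=
    Metric.nhds_basis_ball
  let I : ∀ ε : ℝ, 0 < ε → Ideal (unitBall K) := fun ε hε =>
    { carrier := Metric.ball 0 ε
      add_mem' := fun {x y} hx hy => by
        simp only [mem_ball_zero_iff] at hx hy ⊢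
        exact (IsUltrametricDist.norm_add_le_max x y).trans_lt (max_lt hx hy)
      zero_mem' := by simpa using hε
      smul_mem' := fun r x hx => by
        simp only [mem_ball_zero_iff, smul_eq_mul] at hx ⊢
        refine lt_of_le_of_lt ?_ hx
        exact (norm_mul_le r x).trans (mul_le_of_le_one_left (norm_nonneg _) r.2) }
  refine IsLinearTopology.mk_of_hasBasis (unitBall K) (S := Ideal (unitBall K))
    (ι := {ε : ℝ // 0 < ε}) (p := fun _ => True) (s := fun ε => I ε.1 ε.2) ?_
  refine hb.to_hasBasis (fun ε hε => ⟨⟨ε, hε⟩, trivial, subset_rfl⟩) fun ε _ => ⟨ε.1, ε.2, subset_rfl⟩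

instance [CompleteSpace K] : CompleteSpace (unitBall K) := by
  have : IsClosed (unitBall K : Set K) := isClosed_le continuous_norm continuous_const
  exact this.completeSpace_coe

theorem unitBall.hasEval {n : ℕ} {y : Fin n → unitBall K} (hy : ∀ i, ‖(y i : K)‖ < 1) :
    MvPowerSeries.HasEval y where
  hpow i := tendsto_pow_atTop_nhds_zero_of_norm_lt_one (hy i)
  tendsto_zero := by
    rw [Filter.cofinite_eq_bot]
    exact tendsto_bot

/-- Evaluation of power series with integral coefficients at a point of the open unit polydisc. -/
theorem exists_eval [CompleteSpace K] {n : ℕ} (y : Fin n → unitBall K)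
    (hy : ∀ i, ‖(y i : K)‖ < 1) :
    ∃ φ : MvPowerSeries (Fin n) (unitBall K) →+* unitBall K,
      (∀ r, φ (MvPowerSeries.C r) = r) ∧ (∀ i, φ (MvPowerSeries.X i) = y i) ∧
      ∀ F, HasSum (fun α : Fin n →₀ ℕ => ((MvPowerSeries.coeff α F : unitBall K) : K) *
        α.prod fun i d => (y i : K) ^ d) (φ F : K) := by
  have hev := unitBall.hasEval hy
  refine ⟨(MvPowerSeries.aeval (R := unitBall K) hev).toRingHom,
    fun r => (MvPowerSeries.aeval (R := unitBall K) hev).commutes r, fun i => ?_, fun F => ?_⟩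
  · change MvPowerSeries.aeval (R := unitBall K) hev (MvPowerSeries.X i) = y i
    rw [MvPowerSeries.coe_aeval, MvPowerSeries.eval₂_X]
  · have hsum := (MvPowerSeries.hasSum_aeval (R := unitBall K) hev F).map
      (unitBall K).subtype.toAddMonoidHom continuous_subtype_val
    convert hsum using 1
    · funext α
      simp only [Function.comp_apply, RingHom.toAddMonoidHom_eq_coe, AddMonoidHom.coe_coe,
        Subring.subtype_apply, smul_eq_mul, Subring.coe_mul, Finsupp.prod]
      push_cast
      rfl
    · rfl

/-- Geometric convergence over an ultrametric field. -/
theorem exists_limit_of_geometric [CompleteSpace K] {x : ℕ → K} {r : ℝ} (hr0 : 0 ≤ r) (hr : r < 1)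
    (h : ∀ s, 1 ≤ s → ‖x (s + 1) - x s‖ ≤ r ^ s) :
    ∃ L, Tendsto x atTop (𝓝 L) ∧ ∀ s, 1 ≤ s → ‖x s - L‖ ≤ r ^ s := by
  have hc : CauchySeq fun s => x (s + 1) := by
    refine cauchySeq_of_le_geometric r r hr fun s => ?_
    rw [dist_comm, dist_eq_norm, ← pow_succ']
    exact h (s + 1) (by omega)
  obtain ⟨L, hL⟩ := cauchySeq_tendsto_of_complete hc
  rw [tendsto_add_atTop_iff_nat (f := x) 1] at hL
  refine ⟨L, hL, fun s hs => ?_⟩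
  have h1 : ∀ t, s ≤ t → ‖x s - x t‖ ≤ r ^ s := by
    intro t ht
    induction t, ht using Nat.le_induction with
    | base => simpa using pow_nonneg hr0 s
    | succ t ht ih =>
      rw [← sub_add_sub_cancel (x s) (x t)]
      refine (IsUltrametricDist.norm_add_le_max _ _).trans (max_le ih ?_)
      rw [norm_sub_rev]
      exact (h t (by omega)).trans (pow_le_pow_of_le_one hr0 hr.le ht)
  exact le_of_tendsto (tendsto_const_nhds.sub hL).norm
    (Filter.eventually_atTop.2 ⟨s, h1⟩)

end UnitBall

end PadicKZ

namespace PadicKZ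

open Polynomial Matrix

/-! ### Specialization of `A_s` and `I_s` to points of a commutative ring -/

section Specialization

variable {S T : Type*} [CommRing S] [CommRing T] {n : ℕ}

/-- The polynomial `(t - b_1) ⋯ (t - b_n)`. -/
noncomputable def nodePoly (b : Fin n → S) : S[X] := ∏ j, (X - C (b j))

/-- The quotient of `(t - b_1) ⋯ (t - b_n)` by `t - b_i`. -/
noncomputable def nodePolyErase (b : Fin n → S) (i : Fin n) : S[X] :=
  ∏ j ∈ Finset.univ.erase i, (X - C (b j))

theorem sub_mul_nodePolyErase (b : Fin n → S) (i : Fin n) :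
    (X - C (b i)) * nodePolyErase b i = nodePoly b :=
  Finset.mul_prod_erase Finset.univ (fun j => X - C (b j)) (Finset.mem_univ i)

theorem natDegree_nodePoly [Nontrivial S] (b : Fin n → S) : (nodePoly b).natDegree = n := by
  rw [nodePoly, natDegree_prod_of_monic _ _ fun j _ => monic_X_sub_C _]
  simp

theorem natDegree_nodePolyErase [Nontrivial S] (b : Fin n → S) (i : Fin n) :
    (nodePolyErase b i).natDegree = n - 1 := by
  rw [nodePolyErase, natDegree_prod_of_monic _ _ fun j _ => monic_X_sub_C _]
  simp [Finset.card_erase_of_mem]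

theorem derivative_nodePoly (b : Fin n → S) :
    derivative (nodePoly b) = ∑ i, nodePolyErase b i := by
  rw [nodePoly, derivative_prod_finset]
  simp [nodePolyErase]

theorem map_powProd (b : Fin n → S) (N : ℕ) :
    (powProd n N).map (MvPolynomial.aeval b : MvPolynomial (Fin n) ℤ →ₐ[ℤ] S).toRingHom
      = nodePoly b ^ N := by
  simp [powProd, nodePoly, Polynomial.map_prod, Finset.prod_pow]

theorem map_powProdQuot (b : Fin n → S) {N : ℕ} (hN : 0 < N) (i : Fin n) :
    (powProdQuot n N i).map (MvPolynomial.aeval b : MvPolynomial (Fin n) ℤ →ₐ[ℤ] S).toRingHom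
      = nodePoly b ^ (N - 1) * nodePolyErase b i := by
  obtain ⟨N, rfl⟩ : ∃ M, N = M + 1 := ⟨N - 1, by omega⟩
  rw [← sub_mul_nodePolyErase b i, mul_pow]
  simp only [powProdQuot, nodePolyErase, Polynomial.map_mul, Polynomial.map_pow,
    Polynomial.map_prod, Finset.prod_pow, Polynomial.map_sub, map_X, map_C, Nat.add_sub_cancel]
  simp only [AlgHom.toRingHom_eq_coe, RingHom.coe_coe, MvPolynomial.aeval_X]
  ring

theorem map_aeval_comp (φ : S →+* T) (b : Fin n → S) (x : MvPolynomial (Fin n) ℤ) :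
    φ (MvPolynomial.aeval b x) = MvPolynomial.aeval (fun j => φ (b j)) x := by
  have : φ.toIntAlgHom.comp (MvPolynomial.aeval b) = MvPolynomial.aeval fun j => φ (b j) := by
    ext j
    simp
  rw [← this]
  rfl

variable {p q g : ℕ}

theorem hasseWitt_map (b : Fin (g * q + 1) → S) (s : ℕ) :
    (hasseWitt p q g s).map (MvPolynomial.aeval b)
      = coeffMatrix (p ^ ordMod p q) g (masterExp p q) (nodePoly b) s := by
  ext u v
  rw [coeffMatrix, Matrix.of_apply, ← map_powProd, coeff_map, ← pow_mul]
  rfl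

/-- `Φ_s / (t - z_i)` factors as `P ^ (N s - 1)` times `P / (t - z_i)`, so `I_s` records the same
functionals as `A_s`. -/
theorem hypergeomSol_map (b : Fin (g * q + 1) → S) {s : ℕ} (hs : 0 < masterExp p q s) :
    (hypergeomSol p q g s).map (MvPolynomial.aeval b)
      = Matrix.of fun i v => masterFun (p ^ ordMod p q) g (masterExp p q) (nodePoly b) s v
          (nodePolyErase b i) := by
  ext i v
  rw [Matrix.of_apply, masterFun, coeffMul_apply, ← map_powProdQuot b hs, coeff_map, ← pow_mul]
  rfl

/-- The matrix `I_s(b) A(Φ_s)(b)⁻¹` over a commutative ring. -/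
noncomputable def ringSol (p q g s : ℕ) (b : Fin (g * q + 1) → S) :
    Matrix (Fin (g * q + 1)) (Fin g) S :=
  (hypergeomSol p q g s).map (MvPolynomial.aeval b) *
    ((hasseWitt p q g s).map (MvPolynomial.aeval b))⁻¹

theorem ringSol_map (φ : S →+* T) (b : Fin (g * q + 1) → S) {s : ℕ}
    (h : IsUnit ((hasseWitt p q g s).map (MvPolynomial.aeval b)).det) :
    (ringSol p q g s b).map φ = ringSol p q g s fun j => φ (b j) := by
  have hmap : ∀ {α β : Type} (M : Matrix α β (MvPolynomial (Fin (g * q + 1)) ℤ)),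
      (M.map (MvPolynomial.aeval b)).map φ = M.map (MvPolynomial.aeval fun j => φ (b j)) := by
    intro α β M
    ext i j
    exact map_aeval_comp φ b _
  rw [ringSol, ringSol, Matrix.map_mul, hmap]
  congr 1
  refine (Matrix.inv_eq_right_inv ?_).symm
  rw [← hmap, ← Matrix.map_mul, Matrix.mul_nonsing_inv _ h, Matrix.map_one _ φ.map_zero φ.map_one]

theorem expData_masterExp (hp : p.Prime) (hq : 0 < q) (hg : 0 < g) (h : g < p ^ ordMod p q) :
    ExpData (p ^ ordMod p q) q g (masterExp p q) where
  exp k := by rw [masterExp_mul hp.pos, pow_mul]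
  q_pos := hq
  g_lt := h
  g_pos := hg

/-- A unit determinant for `s = 1` provides the data for the Dwork congruences. -/
theorem dworkData_nodePoly [Nontrivial S] (hE : ExpData (p ^ ordMod p q) q g (masterExp p q))
    (b : Fin (g * q + 1) → S)
    (htor : ∀ x : S, (p : S) * x = 0 → x = 0)
    (hjac : ∀ x y : S, (p : S) ∣ x - y → IsUnit x → IsUnit y)
    (hb : IsUnit ((hasseWitt p q g 1).map (MvPolynomial.aeval b)).det) :
    DworkData S p (ordMod p q) q g (masterExp p q) (nodePoly b) where
  toExpData := hE
  torsion := htor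
  jacobson := hjac
  degree := (natDegree_nodePoly b).le
  unit_one := by rwa [← hasseWitt_map]

theorem DworkData.isUnit_det_hasseWitt [Fact p.Prime] {b : Fin (g * q + 1) → S}
    (D : DworkData S p (ordMod p q) q g (masterExp p q) (nodePoly b)) {s : ℕ} (hs : 1 ≤ s) :
    IsUnit ((hasseWitt p q g s).map (MvPolynomial.aeval b)).det := by
  rw [hasseWitt_map]
  exact D.isUnit_det hs

theorem ringSol_congr [Nontrivial S] [Fact p.Prime] {b : Fin (g * q + 1) → S}
    (D : DworkData S p (ordMod p q) q g (masterExp p q) (nodePoly b)) {s : ℕ} (hs : 1 ≤ s) :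
    ∃ Z : Matrix (Fin (g * q + 1)) (Fin g) S,
      ringSol p q g (s + 1) b - ringSol p q g s b = (p : S) ^ s • Z := by
  obtain ⟨Z, hZ⟩ := D.normalized_congr hs (nodePolyErase b) fun i => by
    rw [natDegree_nodePolyErase]
    have := D.g_pos
    omega
  refine ⟨Z, ?_⟩
  rw [ringSol, ringSol, hypergeomSol_map b (D.N_pos hs), hypergeomSol_map b (D.N_pos (by omega)),
    hasseWitt_map, hasseWitt_map, hZ]

end Specialization

end PadicKZ

namespace PadicKZ

open Matrix

/-! ### Uniform convergence and analyticity on the domain -/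

section Domain

variable {K : Type*} [NontriviallyNormedField K] [IsUltrametricDist K]
  {p q g : ℕ}

theorem torsion_unitBall [CharZero K] (hp0 : p ≠ 0) (x : unitBall K) (h : (p : unitBall K) * x = 0) :
    x = 0 := by
  have h1 : (p : K) * (x : K) = 0 := by simpa using congrArg Subtype.val h
  exact Subtype.ext ((mul_eq_zero.1 h1).resolve_left (Nat.cast_ne_zero.2 hp0))

theorem jacobson_unitBall [CharZero K] (hp0 : p ≠ 0) (hp : ‖(p : K)‖ < 1) (x y : unitBall K)
    (h : (p : unitBall K) ∣ x - y) (hx : IsUnit x) : IsUnit y := by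
  rw [unitBall.isUnit_iff] at hx ⊢
  rw [unitBall.dvd_iff (by simpa using hp0)] at h
  have h1 : ‖(x : K) + -y‖ < max ‖(x : K)‖ ‖-(y : K)‖ := by
    refine lt_max_of_lt_left ?_
    rw [hx, ← sub_eq_add_neg]
    exact lt_of_le_of_lt (by simpa using h) hp
  rw [← hx, IsUltrametricDist.norm_eq_of_add_norm_lt_max h1, norm_neg]

/-- A point of the domain, as a point over the unit ball. -/
def integralPoint {a : Fin (g * q + 1) → K} (ha : a ∈ kzDomain p q g K) :
    Fin (g * q + 1) → unitBall K := fun i => ⟨a i, ha.1 i⟩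

theorem evalMatrix_eq_map {α β : Type*} {n : ℕ} (M : Matrix α β (MvPolynomial (Fin n) ℤ))
    (b : Fin n → unitBall K) :
    evalMatrix M (fun i => (b i : K)) = (M.map (MvPolynomial.aeval b)).map (unitBall K).subtype := by
  ext i j
  exact (map_aeval_comp (unitBall K).subtype b _).symm

theorem det_evalMatrix {α : Type*} [Fintype α] [DecidableEq α] {n : ℕ}
    (M : Matrix α α (MvPolynomial (Fin n) ℤ)) (b : Fin n → unitBall K) :
    (evalMatrix M (fun i => (b i : K))).det = ((M.map (MvPolynomial.aeval b)).det : unitBall K) := by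
  rw [evalMatrix_eq_map]
  exact ((unitBall K).subtype.map_det _).symm

theorem isUnit_det_integralPoint {a : Fin (g * q + 1) → K} (ha : a ∈ kzDomain p q g K) :
    IsUnit ((hasseWitt p q g 1).map (MvPolynomial.aeval (integralPoint ha))).det := by
  rw [unitBall.isUnit_iff, ← det_evalMatrix]
  exact ha.2

variable [CharZero K]

theorem dworkData_integralPoint [Fact p.Prime] (hp : ‖(p : K)‖ < 1)
    (hE : ExpData (p ^ ordMod p q) q g (masterExp p q))
    {a : Fin (g * q + 1) → K} (ha : a ∈ kzDomain p q g K) :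
    DworkData (unitBall K) p (ordMod p q) q g (masterExp p q) (nodePoly (integralPoint ha)) :=
  have hp0 : p ≠ 0 := (Fact.out : p.Prime).ne_zero
  dworkData_nodePoly hE _ (torsion_unitBall hp0) (jacobson_unitBall hp0 hp)
    (isUnit_det_integralPoint ha)

/-- A sequence of power series with integral coefficients whose consecutive terms agree modulo
`p ^ s` converges `p`-adically. -/
theorem exists_powerSeries_limit [CompleteSpace K] (hp0 : p ≠ 0) (hp : ‖(p : K)‖ < 1) {n : ℕ}
    {G : ℕ → MvPowerSeries (Fin n) (unitBall K)}
    (hG : ∀ s, 1 ≤ s → ∃ z, G (s + 1) - G s = MvPowerSeries.C ((p : unitBall K) ^ s) * z) :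
    ∃ F, ∀ s, 1 ≤ s → ∃ z, G s - F = MvPowerSeries.C ((p : unitBall K) ^ s) * z := by
  have hpK : (p : K) ≠ 0 := Nat.cast_ne_zero.2 hp0
  have hlim : ∀ α, ∃ L : K,
      Tendsto (fun s => ((MvPowerSeries.coeff α (G s) : unitBall K) : K)) atTop (𝓝 L) ∧
      ∀ s, 1 ≤ s → ‖((MvPowerSeries.coeff α (G s) : unitBall K) : K) - L‖ ≤ ‖(p : K)‖ ^ s := by
    intro α
    refine exists_limit_of_geometric (norm_nonneg (p : K)) hp fun s hs => ?_
    obtain ⟨z, hz⟩ := hG s hs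
    have h1 := congrArg (fun f => ((MvPowerSeries.coeff α f : unitBall K) : K)) hz
    simp only [map_sub, MvPowerSeries.coeff_C_mul] at h1
    push_cast at h1
    rw [h1, norm_mul, norm_pow]
    exact mul_le_of_le_one_right (by positivity) (MvPowerSeries.coeff α z).2
  choose L hL hL' using hlim
  have hL1 : ∀ α, ‖L α‖ ≤ 1 := fun α =>
    le_of_tendsto (hL α).norm (Eventually.of_forall fun s => (MvPowerSeries.coeff α (G s)).2)
  let F : MvPowerSeries (Fin n) (unitBall K) := fun α => ⟨L α, hL1 α⟩
  have hFc : ∀ α, ((MvPowerSeries.coeff α F : unitBall K) : K) = L α := fun α => rfl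
  refine ⟨F, fun s hs => ?_⟩
  have h1 : ∀ α, (p : unitBall K) ^ s ∣ MvPowerSeries.coeff α (G s - F) := by
    intro α
    rw [unitBall.dvd_iff (by simpa using pow_ne_zero s hpK)]
    simpa [hFc] using hL' α s hs
  choose z hz using h1
  let z' : MvPowerSeries (Fin n) (unitBall K) := z
  have hz' : ∀ α, MvPowerSeries.coeff α z' = z α := fun _ => rfl
  refine ⟨z', ?_⟩
  ext1 α
  rw [hz, MvPowerSeries.coeff_C_mul, hz']

variable [Fact p.Prime] (hp : ‖(p : K)‖ < 1) (hE : ExpData (p ^ ordMod p q) q g (masterExp p q))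
include hp hE

theorem isUnit_det_hasseWitt {a : Fin (g * q + 1) → K} (ha : a ∈ kzDomain p q g K) {s : ℕ}
    (hs : 1 ≤ s) :
    IsUnit ((hasseWitt p q g s).map (MvPolynomial.aeval (integralPoint ha))).det :=
  (dworkData_integralPoint hp hE ha).isUnit_det_hasseWitt hs

theorem norm_det_hasseWitt {a : Fin (g * q + 1) → K} (ha : a ∈ kzDomain p q g K) {s : ℕ}
    (hs : 1 ≤ s) : ‖(evalMatrix (hasseWitt p q g s) a).det‖ = 1 := by
  rw [← unitBall.isUnit_iff.1 (isUnit_det_hasseWitt hp hE ha hs), ← det_evalMatrix]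
  rfl

theorem normalizedSol_eq {a : Fin (g * q + 1) → K} (ha : a ∈ kzDomain p q g K) {s : ℕ}
    (hs : 1 ≤ s) (i l) :
    normalizedSol p q g s a i l = (ringSol p q g s (integralPoint ha) i l : unitBall K) := by
  have h := ringSol_map (unitBall K).subtype (integralPoint ha) (isUnit_det_hasseWitt hp hE ha hs)
  exact (congrFun (congrFun h i) l).symm

theorem norm_normalizedSol_sub_le {a : Fin (g * q + 1) → K} (ha : a ∈ kzDomain p q g K) {s : ℕ}
    (hs : 1 ≤ s) (i l) :
    ‖normalizedSol p q g (s + 1) a i l - normalizedSol p q g s a i l‖ ≤ ‖(p : K)‖ ^ s := by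
  obtain ⟨Z, hZ⟩ := ringSol_congr (dworkData_integralPoint hp hE ha) hs
  have h1 := congrArg Subtype.val (congrFun (congrFun hZ i) l)
  rw [normalizedSol_eq hp hE ha hs, normalizedSol_eq hp hE ha (by omega)]
  have h2 : ((ringSol p q g (s + 1) (integralPoint ha) i l : unitBall K) : K) -
      (ringSol p q g s (integralPoint ha) i l : unitBall K) = (p : K) ^ s * (Z i l : K) := by
    simpa using h1
  rw [h2, norm_mul, norm_pow]
  exact mul_le_of_le_one_right (by positivity) (Z i l).2

theorem limitSol_spec [CompleteSpace K] {a : Fin (g * q + 1) → K} (ha : a ∈ kzDomain p q g K) (i l) :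
    Tendsto (fun s => normalizedSol p q g s a i l) atTop (𝓝 (limitSol p q g a i l)) ∧
      ∀ s, 1 ≤ s → ‖normalizedSol p q g s a i l - limitSol p q g a i l‖ ≤ ‖(p : K)‖ ^ s := by
  obtain ⟨L, hL, hL'⟩ := exists_limit_of_geometric
    (x := fun s => normalizedSol p q g s a i l) (norm_nonneg (p : K)) hp fun s hs => norm_normalizedSol_sub_le hp hE ha hs i l
  have : limitSol p q g a i l = L := hL.limUnder_eq
  rw [this]
  exact ⟨hL, hL'⟩

theorem tendstoUniformlyOn_normalizedSol [CompleteSpace K] (i l) :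
    TendstoUniformlyOn (fun s (a : Fin (g * q + 1) → K) => normalizedSol p q g s a i l)
      (fun a => limitSol p q g a i l) atTop (kzDomain p q g K) := by
  rw [Metric.tendstoUniformlyOn_iff]
  intro ε hε
  have h1 := (tendsto_pow_atTop_nhds_zero_of_lt_one (norm_nonneg (p : K)) hp).eventually_lt_const hε
  filter_upwards [h1, eventually_ge_atTop 1] with s hs hs1 a ha
  rw [dist_comm, dist_eq_norm]
  exact ((limitSol_spec hp hE ha i l).2 s hs1).trans_lt hs

/-- The generic point `a + X` inherits the hypotheses from `a`: a power series is a unit exactly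
when its constant term is, and the constant term here is `det A_1(a)`. -/
theorem dworkData_powerSeries {a : Fin (g * q + 1) → K} (ha : a ∈ kzDomain p q g K) :
    DworkData (MvPowerSeries (Fin (g * q + 1)) (unitBall K)) p (ordMod p q) q g (masterExp p q)
      (nodePoly fun j => MvPowerSeries.C (integralPoint ha j) + MvPowerSeries.X j) := by
  have hp0 : p ≠ 0 := (Fact.out : p.Prime).ne_zero
  have hcast : (p : MvPowerSeries (Fin (g * q + 1)) (unitBall K))
      = MvPowerSeries.C (p : unitBall K) := by simp
  refine dworkData_nodePoly hE _ ?_ ?_ ?_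
  · intro f hf
    ext1 α
    refine torsion_unitBall hp0 _ ?_
    rw [← MvPowerSeries.coeff_C_mul, ← hcast, hf, map_zero]
  · intro f h hfh hf
    rw [MvPowerSeries.isUnit_iff_constantCoeff] at hf ⊢
    refine jacobson_unitBall hp0 hp _ _ ?_ hf
    simpa using map_dvd (MvPowerSeries.constantCoeff) hfh
  · rw [MvPowerSeries.isUnit_iff_constantCoeff, RingHom.map_det]
    convert isUnit_det_integralPoint ha using 2
    ext u v : 1
    simp only [RingHom.mapMatrix_apply, Matrix.map_apply]
    rw [map_aeval_comp]
    simp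

theorem analyticAt_limitSol [CompleteSpace K] {a : Fin (g * q + 1) → K}
    (ha : a ∈ kzDomain p q g K) (i l) :
    AnalyticAt K (fun a : Fin (g * q + 1) → K => limitSol p q g a i l) a := by
  set b : Fin (g * q + 1) → MvPowerSeries (Fin (g * q + 1)) (unitBall K) :=
    fun j => MvPowerSeries.C (integralPoint ha j) + MvPowerSeries.X j with hb
  have D := dworkData_powerSeries hp hE ha
  set G : ℕ → MvPowerSeries (Fin (g * q + 1)) (unitBall K) := fun s => ringSol p q g s b i l with hG
  have hG1 : ∀ s, 1 ≤ s → ∃ z, G (s + 1) - G s = MvPowerSeries.C ((p : unitBall K) ^ s) * z := by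
    intro s hs
    obtain ⟨Z, hZ⟩ := ringSol_congr D hs
    exact ⟨Z i l, by simpa using congrFun (congrFun hZ i) l⟩
  obtain ⟨F, hF⟩ := exists_powerSeries_limit (Fact.out : p.Prime).ne_zero hp hG1
  refine analyticAt_of_hasSum (fun α => ((MvPowerSeries.coeff α F : unitBall K) : K))
    (fun α => (MvPowerSeries.coeff α F).2) _ a fun y hy => ?_
  have hy' : ∀ j, ‖y j‖ < 1 := fun j => (norm_le_pi_norm y j).trans_lt hy
  obtain ⟨φ, hφC, hφX, hφ⟩ := exists_eval (fun j => (⟨y j, (hy' j).le⟩ : unitBall K)) hy'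
  -- Evaluation at `X = y` preserves the congruences modulo `p ^ s` and carries `ringSol` at `a + X`
  -- to `normalizedSol` at `a + y`.
  have hval : limitSol p q g (a + y) i l = (φ F : K) := by
    refine Tendsto.limUnder_eq (tendsto_iff_norm_sub_tendsto_zero.2 ?_)
    refine squeeze_zero' (g := fun s => ‖(p : K)‖ ^ s) (Eventually.of_forall fun _ => norm_nonneg _)
      ?_ (tendsto_pow_atTop_nhds_zero_of_lt_one (norm_nonneg _) hp)
    filter_upwards [eventually_ge_atTop 1] with s hs
    obtain ⟨z, hz⟩ := hF s hs
    have h1 := ringSol_map ((unitBall K).subtype.comp φ) b (D.isUnit_det_hasseWitt hs)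
    have h2 : (fun j => ((unitBall K).subtype.comp φ) (b j)) = a + y := by
      funext j
      simp only [hb, RingHom.comp_apply, map_add, hφC, hφX]
      rfl
    rw [h2] at h1
    have h3 : normalizedSol p q g s (a + y) i l = (φ (G s) : K) :=
      (congrFun (congrFun h1 i) l).symm
    have h4 : (φ (G s) : K) - φ F = (p : K) ^ s * (φ z : K) := by
      have := congrArg (fun f => ((φ f : unitBall K) : K)) hz
      simpa only [map_sub, map_mul, hφC, AddSubgroupClass.coe_sub, Subring.coe_mul, Subring.coe_pow,
        Subring.coe_natCast] using this
    rw [h3, h4, norm_mul, norm_pow]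
    exact mul_le_of_le_one_right (by positivity) (φ z).2
  rw [hval]
  exact hφ F

end Domain

end PadicKZ

namespace PadicKZ

open Polynomial Matrix

/-! ### Exact forms -/

section Exact

variable {R : Type*} [CommRing R] {Q q g : ℕ} {N : ℕ → ℕ}

/-- The functionals kill exact forms modulo `Q ^ k`. -/
theorem ExpData.dvd_masterFun_exact (h : ExpData Q q g N) (P f : R[X]) {k : ℕ} (hk : 1 ≤ k)
    (v : Fin g) :
    (Q : R) ^ k ∣ masterFun Q g N P k v ((q : R[X]) * P * derivative f - derivative P * f) := by
  obtain ⟨M, hM⟩ : ∃ M, N k = M + 1 := ⟨N k - 1, by have := h.N_pos hk; omega⟩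
  have hexp : ((M : R[X]) + 1) * q + 1 = (Q : R[X]) ^ k := by
    have := h.exp k
    rw [hM] at this
    exact_mod_cast congrArg (Nat.cast : ℕ → R[X]) this
  -- This is the product rule for `P ^ N k * f`, with `q N k = Q ^ k - 1`. The derivative's
  -- coefficient at `(v + 1) Q ^ k - 1` carries the factor `(v + 1) Q ^ k`.
  have h1 : P ^ (N k - 1) * ((q : R[X]) * P * derivative f - derivative P * f)
      = (q : R[X]) * derivative (P ^ N k * f) - (Q : R[X]) ^ k * (P ^ M * derivative P * f) := by
    rw [← hexp, hM, derivative_mul, derivative_pow]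
    simp only [Nat.add_sub_cancel, map_add, Nat.cast_add, Nat.cast_one, map_natCast, map_one]
    ring
  have hpos : 1 ≤ ((v : ℕ) + 1) * Q ^ k := Nat.mul_pos (Nat.succ_pos _) (Nat.pow_pos h.Q_pos)
  rw [masterFun, coeffMul_apply, h1, coeff_sub]
  have e1 : (q : R[X]) = C (q : R) := by simp
  have e2 : (Q : R[X]) ^ k = C ((Q : R) ^ k) := by simp
  refine dvd_sub ?_ ?_
  · rw [e1, coeff_C_mul, coeff_derivative]
    have : (((((v : ℕ) + 1) * Q ^ k - 1 : ℕ) : R) + 1) = ((v : R) + 1) * (Q : R) ^ k := by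
      rw [Nat.cast_sub hpos]
      push_cast
      ring
    rw [this]
    exact ((dvd_mul_left _ _).mul_left _).mul_left _
  · rw [e2, coeff_C_mul]
    exact dvd_mul_right _ _

theorem masterFun_map {S : Type*} [CommRing S] (φ : R →+* S) (P f : R[X]) (k : ℕ) (v : Fin g) :
    masterFun Q g N (P.map φ) k v (f.map φ) = φ (masterFun Q g N P k v f) := by
  rw [masterFun, masterFun, coeffMul_apply, coeffMul_apply, ← Polynomial.map_pow,
    ← Polynomial.map_mul, coeff_map]

theorem nodePoly_map {S : Type*} [CommRing S] {n : ℕ} (φ : R →+* S) (b : Fin n → R) :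
    (nodePoly b).map φ = nodePoly fun j => φ (b j) := by
  simp [nodePoly, Polynomial.map_prod]

end Exact

/-! ### Generation of all polynomials by the `P / (t - a_i)` and exact forms -/

section Span

variable {F : Type*} [Field F] {n : ℕ} {a : Fin n → F}

theorem mem_of_degree_lt_of_nodePolyErase_mem (ha : Function.Injective a)
    {V : Submodule F F[X]} (hV : ∀ i, nodePolyErase a i ∈ V) {f : F[X]} (hf : f.degree < n) :
    f ∈ V := by
  rw [Lagrange.eq_interpolate (s := Finset.univ) (v := a) ha.injOn (f := f) (by simpa using hf),
    Lagrange.interpolate_apply]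
  refine Submodule.sum_mem _ fun i _ => ?_
  have : Lagrange.basis Finset.univ a i
      = C (∏ j ∈ Finset.univ.erase i, (a i - a j)⁻¹) * nodePolyErase a i := by
    rw [Lagrange.basis, nodePolyErase, map_prod, ← Finset.prod_mul_distrib]
    rfl
  rw [this, ← smul_eq_C_mul, ← smul_eq_C_mul]
  exact V.smul_mem _ (V.smul_mem _ (hV i))

/-- Polynomials of degree less than `n` and exact forms span all polynomials. -/
theorem mem_of_exact_mem [CharZero F] (ha : Function.Injective a) {q : ℕ}
    (hq : ¬ q ∣ n) {V : Submodule F F[X]} (hV : ∀ i, nodePolyErase a i ∈ V)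
    (hex : ∀ k : ℕ, (q : F[X]) * nodePoly a * derivative (X ^ (k + 1))
      - derivative (nodePoly a) * X ^ (k + 1) ∈ V) (f : F[X]) : f ∈ V := by
  have key : ∀ k : ℕ, ∀ f : F[X], f.degree < (n + k : ℕ) → f ∈ V := by
    intro k
    induction k with
    | zero => exact fun f hf => mem_of_degree_lt_of_nodePolyErase_mem ha hV hf
    | succ k ih =>
      intro f hf
      set D : F[X] := (q : F[X]) * nodePoly a * derivative (X ^ (k + 1))
        - derivative (nodePoly a) * X ^ (k + 1) with hD
      have hmonic : (nodePoly a).Monic := monic_prod_of_monic _ _ fun j _ => monic_X_sub_C _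
      have hdeg := natDegree_nodePoly a
      have hD' : D = C ((q : F) * (k + 1)) * nodePoly a * X ^ k
          - derivative (nodePoly a) * X ^ (k + 1) := by
        rw [hD, derivative_X_pow]
        simp only [Nat.cast_add, Nat.cast_one, map_add, map_mul, map_natCast, map_one,
          Nat.add_sub_cancel]
        ring
      have hn : 0 < n := Nat.pos_of_ne_zero (by rintro rfl; simp at hq)
      have hcoeff : D.coeff (n + k) = (q : F) * (k + 1) - n := by
        have h1 : (nodePoly a).coeff n = 1 := by
          have := hmonic.coeff_natDegree
          rwa [hdeg] at this
        have h2 : (derivative (nodePoly a) * X ^ (k + 1)).coeff (n + k) = (n : F) := by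
          rw [show n + k = (n - 1) + (k + 1) by omega, coeff_mul_X_pow, coeff_derivative,
            Nat.sub_add_cancel hn, h1, one_mul]
          rw [← Nat.cast_add_one, Nat.sub_add_cancel hn]
        rw [hD', coeff_sub, coeff_mul_X_pow, coeff_C_mul, h1, mul_one, h2]
      -- The coefficient `q (k + 1) - n` is nonzero because `q ∤ n`; so `D` removes the term of
      -- degree `n + k`.
      have hc0 : D.coeff (n + k) ≠ 0 := by
        rw [hcoeff, sub_ne_zero]
        intro hcon
        exact hq ⟨k + 1, by exact_mod_cast hcon.symm⟩
      have hDdeg : D.natDegree ≤ n + k := by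
        rw [hD']
        refine (natDegree_sub_le _ _).trans (max_le ?_ ?_)
        · rw [mul_assoc]
          refine (natDegree_C_mul_le _ _).trans (natDegree_mul_le.trans ?_)
          rw [hdeg, natDegree_X_pow]
        · refine natDegree_mul_le.trans ?_
          have := natDegree_derivative_le (nodePoly a)
          rw [natDegree_X_pow]
          omega
      have hsub : f - (f.coeff (n + k) / D.coeff (n + k)) • D ∈ V := by
        refine ih _ ((degree_lt_iff_coeff_zero _ _).2 fun m hm => ?_)
        rw [coeff_sub, coeff_smul, smul_eq_mul]
        rcases hm.eq_or_lt with rfl | hm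
        · rw [div_mul_cancel₀ _ hc0, sub_self]
        · rw [(degree_lt_iff_coeff_zero _ _).1 hf m (by omega),
            coeff_eq_zero_of_natDegree_lt (hDdeg.trans_lt hm), mul_zero, sub_zero]
      have := V.add_mem hsub (V.smul_mem (f.coeff (n + k) / D.coeff (n + k)) (hex k))
      rwa [sub_add_cancel] at this
  refine key (f.natDegree + 1) f (degree_le_natDegree.trans_lt ?_)
  exact_mod_cast (by omega : f.natDegree < n + (f.natDegree + 1))

end Span

/-! ### Column sums and linear independence of the columns of `𝓘(a)` -/

section Fiber

/-- The elements at which a sequence of linear functionals tends to zero. -/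
def tendstoZeroSubmodule {K E : Type*} [NormedField K] [AddCommGroup E] [Module K E]
    (Λ : ℕ → E →ₗ[K] K) : Submodule K E where
  carrier := {f | Tendsto (fun s => Λ s f) atTop (𝓝 0)}
  add_mem' {f f'} hf hf' := by
    have : Tendsto (fun s => Λ s f + Λ s f') atTop (𝓝 (0 + 0)) := Tendsto.add hf hf'
    simpa using this
  zero_mem' := by simp
  smul_mem' r f hf := by
    have : Tendsto (fun s => r * Λ s f) atTop (𝓝 (r * 0)) := Tendsto.const_mul r hf
    simpa using this

variable {K : Type*} [NontriviallyNormedField K] [IsUltrametricDist K] [CharZero K]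
  [CompleteSpace K] {p q g : ℕ} [Fact p.Prime]
  (hp : ‖(p : K)‖ < 1) (hE : ExpData (p ^ ordMod p q) q g (masterExp p q))
include hp hE

omit [CharZero K] [CompleteSpace K] [Fact p.Prime] in
theorem norm_masterFun_exact_le {a : Fin (g * q + 1) → K} (ha : a ∈ kzDomain p q g K)
    (f : (unitBall K)[X]) {s : ℕ} (hs : 1 ≤ s) (v : Fin g) :
    ‖(masterFun (p ^ ordMod p q) g (masterExp p q) (nodePoly (integralPoint ha)) s v
      ((q : (unitBall K)[X]) * nodePoly (integralPoint ha) * derivative f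
        - derivative (nodePoly (integralPoint ha)) * f) : K)‖ ≤ ‖(p : K)‖ ^ s := by
  obtain ⟨z, hz⟩ := hE.dvd_masterFun_exact (nodePoly (integralPoint ha)) f hs v
  have he : 1 ≤ ordMod p q := by
    by_contra! h0
    have := hE.one_lt
    simp [Nat.lt_one_iff.1 h0] at this
  rw [hz]
  push_cast
  rw [norm_mul, norm_pow, norm_pow]
  refine (mul_le_of_le_one_right (by positivity) z.2).trans (pow_le_pow_left₀ (by positivity) ?_ s)
  exact (pow_le_pow_of_le_one (norm_nonneg _) hp.le he).trans (pow_one _).le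

omit [CharZero K] [CompleteSpace K] [Fact p.Prime] in
theorem norm_masterFun_exact_X_pow_le {a : Fin (g * q + 1) → K} (ha : a ∈ kzDomain p q g K)
    (k : ℕ) {s : ℕ} (hs : 1 ≤ s) (v : Fin g) :
    ‖masterFun (p ^ ordMod p q) g (masterExp p q) (nodePoly a) s v
      ((q : K[X]) * nodePoly a * derivative (X ^ k) - derivative (nodePoly a) * X ^ k)‖
      ≤ ‖(p : K)‖ ^ s := by
  have h1 : (nodePoly (integralPoint ha)).map (unitBall K).subtype = nodePoly a := nodePoly_map _ _
  have h2 := norm_masterFun_exact_le hp hE ha (X ^ k) hs v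
  rw [← Subring.subtype_apply, ← masterFun_map] at h2
  simpa only [Polynomial.map_sub, Polynomial.map_mul, Polynomial.map_natCast, ← derivative_map,
    Polynomial.map_pow, map_X, h1] using h2

theorem sum_limitSol {a : Fin (g * q + 1) → K} (ha : a ∈ kzDomain p q g K) (l : Fin g) :
    ∑ i, limitSol p q g a i l = 0 := by
  have h1 : Tendsto (fun s => ∑ i, normalizedSol p q g s a i l) atTop
      (𝓝 (∑ i, limitSol p q g a i l)) :=
    tendsto_finsetSum _ fun i _ => (limitSol_spec hp hE ha i l).1
  refine tendsto_nhds_unique h1 (squeeze_zero_norm' (a := fun s => ‖(p : K)‖ ^ s) ?_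
    (tendsto_pow_atTop_nhds_zero_of_lt_one (norm_nonneg _) hp))
  filter_upwards [eventually_ge_atTop 1] with s hs
  set A := ((hasseWitt p q g s).map (MvPolynomial.aeval (integralPoint ha)))⁻¹ with hA
  -- `∑ P / (t - a_i) = P'` is minus the exact form of `f = 1`.
  have h2 : ∑ i, normalizedSol p q g s a i l = ∑ v,
      -(masterFun (p ^ ordMod p q) g (masterExp p q) (nodePoly (integralPoint ha)) s v
        ((q : (unitBall K)[X]) * nodePoly (integralPoint ha) * derivative 1
        - derivative (nodePoly (integralPoint ha)) * 1) : K) * (A v l : K) := by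
    have h3 : ∀ i, normalizedSol p q g s a i l = ∑ v, (masterFun (p ^ ordMod p q) g
        (masterExp p q) (nodePoly (integralPoint ha)) s v
          (nodePolyErase (integralPoint ha) i) : K) * (A v l : K) := by
      intro i
      rw [normalizedSol_eq hp hE ha hs, ringSol, hypergeomSol_map _ (hE.N_pos hs),
        Matrix.mul_apply]
      push_cast
      rfl
    rw [Finset.sum_congr rfl fun i _ => h3 i, Finset.sum_comm]
    refine Finset.sum_congr rfl fun v _ => ?_
    rw [← Finset.sum_mul, derivative_one, mul_zero, mul_one, zero_sub, map_neg,
      derivative_nodePoly, map_sum]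
    push_cast
    rw [neg_neg]
  rw [h2]
  refine IsUltrametricDist.norm_sum_le_of_forall_le_of_nonneg (by positivity) fun v _ => ?_
  rw [norm_mul, norm_neg]
  exact (mul_le_of_le_one_right (norm_nonneg _) (A v l).2).trans
    (norm_masterFun_exact_le hp hE ha 1 hs v)

theorem fiberL_le_sumZero {a : Fin (g * q + 1) → K} (ha : a ∈ kzDomain p q g K) :
    fiberL p q g a ≤ sumZero (g * q + 1) K := by
  rw [fiberL, Submodule.span_le]
  rintro _ ⟨l, rfl⟩
  exact sum_limitSol hp hE ha l

theorem linearIndependent_limitSol (hq : 1 < q) {a : Fin (g * q + 1) → K}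
    (ha : a ∈ kzDomainOff p q g K) : LinearIndependent K (limitSol p q g a).col := by
  obtain ⟨ha, hne⟩ := ha
  have hinj : Function.Injective a := fun i j hij => by
    by_contra h
    exact hne i j h hij
  rw [Fintype.linearIndependent_iff]
  intro c hc u
  set e := ordMod p q
  set b := integralPoint ha with hb
  set A : ℕ → Matrix (Fin g) (Fin g) K := fun s => evalMatrix (hasseWitt p q g s) a with hA
  set Λ : ℕ → K[X] →ₗ[K] K := fun s => ∑ l, ((A s)⁻¹ *ᵥ c) l •
    masterFun (p ^ e) g (masterExp p q) (nodePoly a) s l with hΛ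
  have hΛ_apply : ∀ s f, Λ s f = ∑ l, masterFun (p ^ e) g (masterExp p q) (nodePoly a) s l f *
      ((A s)⁻¹ *ᵥ c) l := by
    intro s f
    simp only [hΛ, LinearMap.sum_apply, LinearMap.smul_apply, smul_eq_mul, mul_comm]
  -- `A_s⁻¹` is integral because `det A_s` is a unit. This bound, uniform in `s`, makes `Λ s` tend
  -- to zero on exact forms.
  have hbound : ∀ s, 1 ≤ s → ∀ l, ‖((A s)⁻¹ *ᵥ c) l‖ ≤ ∑ j, ‖c j‖ := by
    intro s hs l
    have hu := isUnit_det_hasseWitt hp hE ha hs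
    have hinv : (A s)⁻¹ = (((hasseWitt p q g s).map (MvPolynomial.aeval b))⁻¹).map
        (unitBall K).subtype := by
      refine Matrix.inv_eq_right_inv ?_
      have : A s = ((hasseWitt p q g s).map (MvPolynomial.aeval b)).map (unitBall K).subtype :=
        evalMatrix_eq_map _ b
      rw [this, ← Matrix.map_mul, Matrix.mul_nonsing_inv _ hu, Matrix.map_one _ (map_zero _)
        (map_one _)]
    rw [Matrix.mulVec, dotProduct]
    refine (norm_sum_le _ _).trans (Finset.sum_le_sum fun j _ => ?_)
    rw [norm_mul, hinv]
    exact mul_le_of_le_one_left (norm_nonneg _) (unitBall.norm_le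
      (((hasseWitt p q g s).map (MvPolynomial.aeval b))⁻¹ l j))
  set V : Submodule K K[X] := tendstoZeroSubmodule Λ
  have hnode : ∀ i, nodePolyErase a i ∈ V := by
    intro i
    have h1 : Tendsto (fun s => ∑ l, normalizedSol p q g s a i l * c l) atTop
        (𝓝 (∑ l, limitSol p q g a i l * c l)) :=
      tendsto_finsetSum _ fun l _ => ((limitSol_spec hp hE ha i l).1).mul_const _
    have h2 : ∑ l, limitSol p q g a i l * c l = 0 := by
      have := congrFun hc i
      simpa [Finset.sum_apply, mul_comm] using this
    rw [h2] at h1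
    refine h1.congr' ?_
    filter_upwards [eventually_ge_atTop 1] with s hs
    have h3 : ∑ l, normalizedSol p q g s a i l * c l = (normalizedSol p q g s a *ᵥ c) i := rfl
    have h4 : evalMatrix (hypergeomSol p q g s) a = _ := hypergeomSol_map a (hE.N_pos hs)
    rw [h3, normalizedSol, ← Matrix.mulVec_mulVec, hΛ_apply, h4]
    rfl
  have hex : ∀ k : ℕ, (q : K[X]) * nodePoly a * derivative (X ^ (k + 1))
      - derivative (nodePoly a) * X ^ (k + 1) ∈ V := by
    intro k
    refine squeeze_zero_norm' (a := fun s => ‖(p : K)‖ ^ s * ∑ j, ‖c j‖) ?_ ?_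
    · filter_upwards [eventually_ge_atTop 1] with s hs
      rw [hΛ_apply]
      refine IsUltrametricDist.norm_sum_le_of_forall_le_of_nonneg
        (mul_nonneg (by positivity) (Finset.sum_nonneg fun _ _ => norm_nonneg _)) fun l _ => ?_
      rw [norm_mul]
      refine mul_le_mul ?_ (hbound s hs l) (norm_nonneg _) (by positivity)
      exact norm_masterFun_exact_X_pow_le hp hE ha (k + 1) hs l
    · simpa using (tendsto_pow_atTop_nhds_zero_of_lt_one (norm_nonneg (p : K)) hp).mul_const
        (∑ j, ‖c j‖)
  have hdvd : ¬ q ∣ g * q + 1 := by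
    rw [Nat.dvd_add_right (dvd_mul_left _ _), Nat.dvd_one]
    omega
  -- On `P X ^ u` the functional `Λ s` takes the value `(A_s A_s⁻¹ c)_u = c_u` for every `s ≥ 1`.
  have hfin : Tendsto (fun s => Λ s (nodePoly a * X ^ (u : ℕ))) atTop (𝓝 0) :=
    mem_of_exact_mem hinj hdvd hnode hex _
  refine tendsto_nhds_unique (tendsto_const_nhds.congr' ?_) hfin
  filter_upwards [eventually_ge_atTop 1] with s hs
  have h6 : A s = _ := hasseWitt_map a s
  have hu : IsUnit (A s).det := by
    rw [isUnit_iff_ne_zero, ← norm_ne_zero_iff, norm_det_hasseWitt hp hE ha hs]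
    exact one_ne_zero
  have h7 : c u = (A s *ᵥ ((A s)⁻¹ *ᵥ c)) u := by
    rw [Matrix.mulVec_mulVec, Matrix.mul_nonsing_inv _ hu, Matrix.one_mulVec]
  rw [h7, hΛ_apply, Matrix.mulVec, dotProduct]
  refine Finset.sum_congr rfl fun l _ => ?_
  congr 1
  rw [h6, hE.coeffMatrix_apply _ hs]
  rfl

end Fiber

end PadicKZ

namespace PadicKZ

/-! ### Openness of the domain and completeness of the unramified extension -/

section Main

/-- Closed balls and spheres of nonzero radius are open in an ultrametric field. -/
theorem isOpen_kzDomainOff {K : Type*} [NontriviallyNormedField K] [IsUltrametricDist K]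
    (p q g : ℕ) : IsOpen (kzDomainOff p q g K) := by
  have h1 : IsOpen {a : Fin (g * q + 1) → K | ∀ i, ‖a i‖ ≤ 1} := by
    simp only [Set.ofPred_forall]
    refine isOpen_iInter_of_finite fun i => ?_
    have := (IsUltrametricDist.isOpen_closedBall (0 : K) one_ne_zero).preimage
      (continuous_apply (A := fun _ : Fin (g * q + 1) => K) i)
    simpa [Set.preimage] using this
  have h2 : IsOpen {a : Fin (g * q + 1) → K |
      ‖(evalMatrix (hasseWitt p q g 1) a).det‖ = 1} := by
    have hc : Continuous fun a : Fin (g * q + 1) → K =>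
        (evalMatrix (hasseWitt p q g 1) a).det := by
      refine Continuous.matrix_det (continuous_matrix fun u v => ?_)
      have h := MvPolynomial.continuous_eval
        (MvPolynomial.map (algebraMap ℤ K) (hasseWitt p q g 1 u v))
      simp only [← MvPolynomial.eval₂_eq_eval_map] at h
      exact h
    have := (IsUltrametricDist.isOpen_sphere (0 : K) one_ne_zero).preimage hc
    simpa [Set.preimage] using this
  have h3 : IsOpen {a : Fin (g * q + 1) → K | ∀ i j, i ≠ j → a i ≠ a j} := by
    simp only [Set.ofPred_forall]
    refine isOpen_iInter_of_finite fun i => isOpen_iInter_of_finite fun j =>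
      isOpen_iInter_of_finite fun _ => ?_
    exact isOpen_ne_fun (continuous_apply i) (continuous_apply j)
  exact (h1.inter h2).inter h3

variable (p m : ℕ) [Fact p.Prime]

instance : IsUltrametricDist (UnramifiedExt p m) where
  dist_triangle_max x y z := dist_triangle_max (x : PadicAlgCl p) y z

theorem norm_natCast_unramifiedExt_lt_one : ‖(p : UnramifiedExt p m)‖ < 1 := by
  have h1 : ‖(p : UnramifiedExt p m)‖ = ‖((p : ℚ_[p]) : PadicAlgCl p)‖ := by
    change ‖((p : UnramifiedExt p m) : PadicAlgCl p)‖ = _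
    simp
  rw [h1, PadicAlgCl.norm_extends]
  exact Padic.norm_p_lt_one

theorem finiteDimensional_unramifiedExt (hm : 0 < m) :
    FiniteDimensional ℚ_[p] (UnramifiedExt p m) := by
  classical
  -- Positive order makes the set of adjoined roots finite; order `0` would mean all elements that
  -- are not roots of unity.
  have hpos : 0 < p ^ m - 1 :=
    Nat.sub_pos_of_lt (Nat.one_lt_pow hm.ne' (Fact.out : p.Prime).one_lt)
  have hfin : Set.Finite {ζ : PadicAlgCl p | IsPrimitiveRoot ζ (p ^ m - 1)} := by
    refine (Polynomial.nthRoots (p ^ m - 1) (1 : PadicAlgCl p)).toFinset.finite_toSet.subset ?_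
    intro ζ hζ
    simpa [Polynomial.mem_nthRoots hpos] using (hζ : IsPrimitiveRoot ζ _).pow_eq_one
  have := hfin.to_subtype
  exact IntermediateField.finiteDimensional_adjoin fun x _ =>
    (Algebra.IsAlgebraic.isAlgebraic x).isIntegral

theorem completeSpace_unramifiedExt (hm : 0 < m) : CompleteSpace (UnramifiedExt p m) :=
  have := finiteDimensional_unramifiedExt p m hm
  FiniteDimensional.complete ℚ_[p] (UnramifiedExt p m)

end Main

end PadicKZ

theorem mainTheorem12 (p q g m : ℕ) [Fact p.Prime] (hq : q.Prime) (hqp : q < p)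
    (hg : 0 < g) (hm : 0 < m)
    (hpe : g * q + 1 < p ^ PadicKZ.ordMod p q) (hpn : (g * q + 1) + q ≤ p + 2) :
    -- the matrices `A(Φ_s)(a)` are invertible on the domain
    (∀ a ∈ PadicKZ.kzDomain p q g (PadicKZ.UnramifiedExt p m), ∀ s : ℕ, 1 ≤ s →
      ‖(PadicKZ.evalMatrix (PadicKZ.hasseWitt p q g s) a).det‖ = 1) ∧
    -- the limit that defines `𝓘` is uniform on the domain, and `𝓘` is analytic there
    (∀ i l, TendstoUniformlyOn
      (fun (s : ℕ) (a : Fin (g * q + 1) → PadicKZ.UnramifiedExt p m) =>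
        PadicKZ.normalizedSol p q g s a i l)
      (fun a => PadicKZ.limitSol p q g a i l) atTop
      (PadicKZ.kzDomain p q g (PadicKZ.UnramifiedExt p m))) ∧
    (∀ i l, AnalyticOnNhd (PadicKZ.UnramifiedExt p m)
      (fun a : Fin (g * q + 1) → PadicKZ.UnramifiedExt p m => PadicKZ.limitSol p q g a i l)
      (PadicKZ.kzDomain p q g (PadicKZ.UnramifiedExt p m))) ∧
    -- `𝓛_a` is a subspace of `W`
    (∀ a ∈ PadicKZ.kzDomain p q g (PadicKZ.UnramifiedExt p m),
      PadicKZ.fiberL p q g a ≤ PadicKZ.sumZero (g * q + 1) (PadicKZ.UnramifiedExt p m)) ∧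
    -- the rank is constant, and `𝓛` is an analytic vector bundle off the diagonals
    ∃ r : ℕ,
      (∀ a ∈ PadicKZ.kzDomainOff p q g (PadicKZ.UnramifiedExt p m),
        Module.finrank (PadicKZ.UnramifiedExt p m) (PadicKZ.fiberL p q g a) = r) ∧
      PadicKZ.IsAnalyticSubbundle (K := PadicKZ.UnramifiedExt p m)
        (PadicKZ.kzDomainOff p q g (PadicKZ.UnramifiedExt p m))
        (fun a => PadicKZ.fiberL p q g a) r := by
  have hc := PadicKZ.completeSpace_unramifiedExt p m hm
  have hp := PadicKZ.norm_natCast_unramifiedExt_lt_one p m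
  have hgQ : g < p ^ PadicKZ.ordMod p q := by
    have := Nat.le_mul_of_pos_right g hq.pos
    omega
  have hE := PadicKZ.expData_masterExp (Fact.out : p.Prime) hq.pos hg hgQ
  have hcz : CharZero (PadicKZ.UnramifiedExt p m) :=
    charZero_of_injective_algebraMap (algebraMap ℚ_[p] (PadicKZ.UnramifiedExt p m)).injective
  refine ⟨fun a ha s hs => PadicKZ.norm_det_hasseWitt hp hE ha hs,
    fun i l => PadicKZ.tendstoUniformlyOn_normalizedSol hp hE i l,
    fun i l a ha => PadicKZ.analyticAt_limitSol hp hE ha i l,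
    fun a ha => PadicKZ.fiberL_le_sumZero hp hE ha, g, fun a ha => ?_, fun a ha => ?_⟩
  · rw [PadicKZ.fiberL,
      finrank_span_eq_card (PadicKZ.linearIndependent_limitSol hp hE hq.one_lt ha),
      Fintype.card_fin]
  · refine ⟨_, PadicKZ.isOpen_kzDomainOff p q g, ha, subset_rfl,
      fun j x => (PadicKZ.limitSol p q g x).col j, fun j x hx => ?_, fun x hx =>
        ⟨PadicKZ.linearIndependent_limitSol hp hE hq.one_lt hx, rfl⟩⟩
    exact AnalyticAt.pi fun i => PadicKZ.analyticAt_limitSol hp hE hx.1 i j
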